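/- **Setting.** Let $N\ge 1$, $\Omega_x=[x_{\min},x_{\max}]$, $\Omega_y=[y_{\min},y_{\max}]$, $\Omega_z=\prod_{i=1}^N[z_{i,\min},z_{i,\max}]$ be nondegenerate, $\Omega=\Omega_x\times\Omega_y\times\Omega_z$, $\theta_0\in\mathbb R^m$ and $\emptyset\ne\Theta\subset\mathbb R^m$. The leader's utility is $U_X(x,y,z)=B(x,\theta_0)+f_1(y,z)x$, the middle follower's is $U_Y(x,y,\theta)=f_2(x,\theta)y+f_3(x)$, and bottom follower $i$'s is $U_{Z_i}=f_{4_i}(x,y,z_i,z_{-i},\theta)$. Let $\mathrm{BR}_Y(x,\theta)=\arg\max_{y\in\Omega_y}U_Y(x,y,\theta)$, and let $\mathrm{BR}_Z(x,y,\theta)$ be the set of Nash equilibria $z\in\Omega_z$ of the bottom-level game; where it is a single point the same symbol denotes that point. Let $\bar U(x,\theta)$ and $\underline U(x,\theta)$ be the maximum and the minimum of $U_X(x,y,z)$ over $y\in \mathrm{BR}_Y(x,\theta)$, $z\in\mathrm{BR}_Z(x,y,\theta)$. A tuple $(x^*,y^*,z^*,\theta^*)$ with $x^*\in\Omega_x$,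 $\theta^*\in\Theta$, $y^*\in\mathrm{BR}_Y(x^*,\theta^*)$, $z^*\in\mathrm{BR}_Z(x^*,y^*,\theta^*)$ is an SDSE (resp. WDSE) if $(x^*,\theta^*)$ maximizes $\bar U$ (resp. $\underline U$) over $\Omega_x\times\Theta$ and $(y^*,z^*)$ attains the inner maximum (resp. minimum). Put $F=\mathrm{col}(-\nabla_{z_i}f_{4_i})_{i}$. **Assumptions.** All conditions hold for every $\theta\in\Theta$. (2.1) $U_X,U_Y,U_{Z_i}$ are concave in $x$, $y$, $z_i$ respectively and $C^1$ on $\Omega$; $\Theta$ is finite. (2.2) For fixed $x,y,\theta$ the map $F(x,y,\cdot,\theta)$ is $\mu$-strongly monotone and $\kappa$-Lipschitz on $\Omega_z$ ($\mu,\kappa>0$), and $F(\cdot,\cdot,\cdot,\theta)$ is $C^1$ on $\Omega$. (2.3) $\nabla_xB(\cdot,\theta_0)$ and $\nabla_zf_1$ are Lipschitz; $f_2(\cdot,\theta)$ has finitely many zeros in $\Omega_x$; $F(\cdot,\cdot,\cdot,\theta)$ is definable in an o-minimal expansion of the real field; and $\mathrm J_1F$, $\mathrm J_3F$ (the partial Jacobians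 in $x$ and $z$) are Lipschitz in $z$ with a common constant $L_F$. The zeros of $f_2(\cdot,\theta)$ divide $\Omega_x$ into nondegenerate closed intervals $\Omega_{x,i}$ without zeros in their interiors. On $\Omega_{x,i}$ let $\phi_1=y_{\max}$ or $y_{\min}$ according to whether $f_2(\cdot,\theta)$ is positive or negative in the interior, and let $\phi_2(x)=\mathrm{BR}_Z(x,\phi_1,\theta)$ and $\hat U_X(x,\theta)=U_X(x,\phi_1,\phi_2(x))$. (4.1) For every fixed $y\in\Omega_y$, $x\mapsto U_X(x,y,\mathrm{BR}_Z(x,y,\theta))$ is concave on every $\Omega_{x,i}$. **Algorithm.** Let $0<\gamma<2\mu/\kappa^2$, $\eta=\sqrt{1-\gamma(2\mu-\gamma\kappa^2)}$, $\omega(x,y,z)=z-\gamma F(x,y,z,\theta)$ and $h=\mathbb P_{\Omega_z}\circ\,\omega$, with $\mathrm J_1h=-\gamma D\,\mathrm J_1F$ and $\mathrm J_3h=D(I-\gamma\,\mathrm J_3F)$, where $D=D(\omega)$ is the Jacobian of $\mathbb P_{\Omega_z}$ at $\omega$ (at points of nondifferentiability, a fixed choice of an element of its Clarke Jacobian). Let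 steps $\alpha^k\ge0$ and tolerances $\sigma^k>0$ satisfy $\sum\alpha^k=\infty$, $\sum(\alpha^k)^2<\infty$, $\sum\alpha^k\sigma^k<\infty$. For each $\theta\in\Theta$ and each $\Omega_{x,i}$, start from any $x^0\in\Omega_{x,i}$, $z^0\in\Omega_z$, $s^0\in\mathbb R^N$. Given $(x^k,z^k,s^k)$, the inner loop (with $x=x^k$, $y=\phi_1$) first iterates $z\leftarrow h(x,y,z)$ from $z^k$, at least once, until a step has length at most $\sigma^k$. From the resulting point $\tilde z^0$ and $\tilde s^0=s^k$ it then iterates $\tilde z^{\ell+1}=h(x,y,\tilde z^\ell)$, $\tilde s^{\ell+1}=\mathrm J_1h(x,y,\tilde z^{\ell+1})+\mathrm J_3h(x,y,\tilde z^{\ell+1})\tilde s^\ell$ until the first $\ell\ge1$ with $\max\{\eta^\ell,\sum_{j=0}^{\ell}\eta^{\ell-j}\|\tilde z^{j+1}-\tilde z^j\|\}\le\sigma^k$, and returns $(z^{k+1},s^{k+1})=(\tilde z^\ell,\tilde s^\ell)$. Then $$x^{k+1}=\mathbb P_{\Omega_{x,i}}\big[x^k+\alpha^k\big(\nabla_xU_X(x^k,\phi_1,z^{k+1})+(s^{k+1})^\top\nabla_zU_X(x^k,\phi_1,z^{k+1})\big)\big].$$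 The candidates for $\theta$ are the limits $\bar x$ of $(x^k)$ on the intervals, with utility $\hat U_X(\bar x,\theta)$, and the zeros $x_j$ of $f_2(\cdot,\theta)$, with utility $\sup_{y\in\Omega_y}U_X(x_j,y,\mathrm{BR}_Z(x_j,y,\theta))$ in the optimistic (SDSE) version and the corresponding $\inf$ in the pessimistic (WDSE) version. An output $(U^*,x^*,\theta^*)$ is any candidate of largest utility over all $\theta\in\Theta$. **Assumptions on the iterates.** Let $(A_j)$ be the closed hyper-rectangular regions of $\mathbb R^N$ cut out coordinatewise by the bounds $z_{i,\min},z_{i,\max}$, let $\mathcal P(x)=\{j:\omega(x,\phi_1,\phi_2(x))\in A_j\}$, and let $\delta(x)$ be the largest radius of a ball around $\omega(x,\phi_1,\phi_2(x))$ contained in $\bigcup_{j\in\mathcal P(x)}A_j$. For every $\theta$ and every $\Omega_{x,i}$: (4.2) $\sigma^k<\delta(x^k)$ for all sufficiently large $k$; and $\mathcal P(x^k)$ is a singleton for all but finitely many $k$. **Theorem.** Under these assumptions, for every $\theta\in\Theta$ and every interval $\Omega_{x,i}$ all inner loops terminate and $(x^k)$ converges to a point of $\Omega_{x,i}$; both versions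 of the algorithm have an output; and: 1. (optimistic version) for every output $(U^*,x^*,\theta^*)$ there are $y^*,z^*$ such that $(x^*,y^*,z^*,\theta^*)$ is an SDSE with $U^*=U_X(x^*,y^*,z^*)$; 2. (pessimistic version) for every output $(U^*,x^*,\theta^*)$ one has $U^*=\sup_{x\in\Omega_x,\theta\in\Theta}\underline U(x,\theta)$, and there are $y^*,z^*$ such that $(x^*,y^*,z^*,\theta^*)$ is a WDSE with $U^*=U_X(x^*,y^*,z^*)$ if and only if $f_2(x^*,\theta^*)\ne0$ or $\underline U(\cdot,\theta^*)$ is upper semicontinuous at $x^*$ (relative to $\Omega_x$). -/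

import Mathlib

open Set Filter Topology

noncomputable section

namespace Deception

/-- Euclidean space of dimension `n`. -/
abbrev E (n : ℕ) := EuclideanSpace ℝ (Fin n)

/-! ### Definability in an o-minimal structure -/

/-- The first-order structure `L` on `ℝ` is an o-minimal expansion of the real field: the graphs of
`+` and `*` are definable, and every definable subset of `ℝ` (parameters allowed) is a finite union
of points and intervals, that is, of order-connected sets. -/
def IsOMinimalExpansion (L : FirstOrder.Language.{0, 0}) [L.Structure ℝ] : Prop :=
  (univ : Set ℝ).Definable L {v : Fin 3 → ℝ | v 0 + v 1 = v 2} ∧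
  (univ : Set ℝ).Definable L {v : Fin 3 → ℝ | v 0 * v 1 = v 2} ∧
  ∀ s : Set ℝ, (univ : Set ℝ).Definable₁ L s →
    ∃ T : Set (Set ℝ), T.Finite ∧ (∀ t ∈ T, t.OrdConnected) ∧ s = ⋃₀ T

/-- A subset of `ℝ^α` is definable if it is definable in some o-minimal expansion of the real
field. -/
def IsDefinableSet {α : Type} (s : Set (α → ℝ)) : Prop :=
  ∃ (L : FirstOrder.Language.{0, 0}) (_ : L.Structure ℝ),
    IsOMinimalExpansion L ∧ (univ : Set ℝ).Definable L s

/-! ### The game -/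

/-- The data of the three-party deception game with `N` bottom-level followers and deception
parameters in `ℝ^m`. The functions are only used on the strategy sets given by the bounds. -/
structure Game (N m : ℕ) where
  xmin : ℝ
  xmax : ℝ
  ymin : ℝ
  ymax : ℝ
  zmin : Fin N → ℝ
  zmax : Fin N → ℝ
  /-- the true parameter -/
  θ₀ : E m
  /-- the deception set -/
  Θ : Set (E m)
  B : ℝ → E m → ℝ
  f₁ : ℝ → E N → ℝ
  f₂ : ℝ → E m → ℝ
  f₃ : ℝ → ℝ
  f₄ : Fin N → ℝ → ℝ → E N → E m → ℝ

namespace Game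

variable {N m : ℕ} (G : Game N m)

def Ωx : Set ℝ := Icc G.xmin G.xmax

def Ωy : Set ℝ := Icc G.ymin G.ymax

def Ωz : Set (E N) := {z | ∀ i, z i ∈ Icc (G.zmin i) (G.zmax i)}

def Ω : Set (ℝ × ℝ × E N) := G.Ωx ×ˢ G.Ωy ×ˢ G.Ωz

/-- The leader's utility under the true parameter. -/
def UX (x y : ℝ) (z : E N) : ℝ := G.B x G.θ₀ + G.f₁ y z * x

/-- The middle-level follower's utility. -/
def UY (x y : ℝ) (θ : E m) : ℝ := G.f₂ x θ * y + G.f₃ x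

/-- The utility of the bottom-level follower `i`, as a function of the whole profile `z`. -/
def UZ (i : Fin N) (x y : ℝ) (z : E N) (θ : E m) : ℝ := G.f₄ i x y z θ

/-- The profile `(t, z₋ᵢ)`. -/
def setCoord (z : E N) (i : Fin N) (t : ℝ) : E N :=
  WithLp.toLp 2 (Function.update (fun j => z j) i t)

/-- Best responses of the middle-level follower. -/
def BRY (x : ℝ) (θ : E m) : Set ℝ :=
  {y | y ∈ G.Ωy ∧ ∀ y' ∈ G.Ωy, G.UY x y' θ ≤ G.UY x y θ}

/-- Best responses of the bottom level: the Nash equilibria of its simultaneous game. -/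
def BRZ (x y : ℝ) (θ : E m) : Set (E N) :=
  {z | z ∈ G.Ωz ∧ ∀ i, ∀ t ∈ Icc (G.zmin i) (G.zmax i),
    G.UZ i x y (setCoord z i t) θ ≤ G.UZ i x y z θ}

open Classical in
/-- The bottom-level equilibrium as a point; it is used where `BRZ` is a singleton. -/
def brZ (x y : ℝ) (θ : E m) : E N := Classical.epsilon fun z => z ∈ G.BRZ x y θ

/-! ### Equilibria -/

/-- The leader's utilities at `(x, θ)` over all best responses of the followers. -/
def responseValues (x : ℝ) (θ : E m) : Set ℝ :=
  {u | ∃ y ∈ G.BRY x θ, ∃ z ∈ G.BRZ x y θ, u = G.UX x y z}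

/-- The pessimistic utility of the leader. -/
def worst (x : ℝ) (θ : E m) : ℝ := sInf (G.responseValues x θ)

/-- The optimistic utility of the leader. -/
def best (x : ℝ) (θ : E m) : ℝ := sSup (G.responseValues x θ)

/-- Weak deception Stackelberg equilibrium. -/
def IsWDSE (x y : ℝ) (z : E N) (θ : E m) : Prop :=
  x ∈ G.Ωx ∧ θ ∈ G.Θ ∧ y ∈ G.BRY x θ ∧ z ∈ G.BRZ x y θ ∧
  IsLeast (G.responseValues x θ) (G.UX x y z) ∧
  ∀ x' ∈ G.Ωx, ∀ θ' ∈ G.Θ, G.worst x' θ' ≤ G.worst x θ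

/-- Strong deception Stackelberg equilibrium. -/
def IsSDSE (x y : ℝ) (z : E N) (θ : E m) : Prop :=
  x ∈ G.Ωx ∧ θ ∈ G.Θ ∧ y ∈ G.BRY x θ ∧ z ∈ G.BRZ x y θ ∧
  IsGreatest (G.responseValues x θ) (G.UX x y z) ∧
  ∀ x' ∈ G.Ωx, ∀ θ' ∈ G.Θ, G.best x' θ' ≤ G.best x θ

/-! ### The pseudogradient and its partial Jacobians -/

/-- The pseudogradient `F = col(-∇_{z_i} f_{4,i})`. -/
def F (x y : ℝ) (z : E N) (θ : E m) : E N :=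
  WithLp.toLp 2 fun i =>
    -derivWithin (fun t => G.f₄ i x y (setCoord z i t) θ) (Icc (G.zmin i) (G.zmax i)) (z i)

/-- The partial Jacobian of `F` in `x`. -/
def J₁F (x y : ℝ) (z : E N) (θ : E m) : E N :=
  derivWithin (fun t => G.F t y z θ) G.Ωx x

/-- The partial Jacobian of `F` in `z`. -/
def J₃F (x y : ℝ) (z : E N) (θ : E m) : E N →L[ℝ] E N :=
  fderivWithin ℝ (fun w => G.F x y w θ) G.Ωz z

/-- The graph of `F(·, ·, ·, θ)` on `Ω`, as a subset of a real coordinate space. -/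
def graphF (θ : E m) : Set ((Fin 2 ⊕ Fin N) ⊕ Fin N → ℝ) :=
  {v | (v (.inl (.inl 0)), v (.inl (.inl 1)), WithLp.toLp 2 fun i => v (.inl (.inr i))) ∈ G.Ω ∧
    ∀ i, G.F (v (.inl (.inl 0))) (v (.inl (.inl 1)))
      (WithLp.toLp 2 fun j => v (.inl (.inr j))) θ i = v (.inr i)}

/-! ### Standing assumptions -/

/-- There is at least one bottom-level follower and one deception parameter, and the strategy
intervals are nondegenerate. -/
def Nondegenerate : Prop :=
  0 < N ∧ G.Θ.Nonempty ∧ G.xmin < G.xmax ∧ G.ymin < G.ymax ∧ ∀ i, G.zmin i < G.zmax i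

/-- Concavity in the own variable, continuous differentiability, finitely many parameters. -/
structure UtilityAssumption : Prop where
  concave_X : ∀ y ∈ G.Ωy, ∀ z ∈ G.Ωz, ConcaveOn ℝ G.Ωx fun x => G.UX x y z
  concave_Y : ∀ θ ∈ G.Θ, ∀ x ∈ G.Ωx, ConcaveOn ℝ G.Ωy fun y => G.UY x y θ
  concave_Z : ∀ θ ∈ G.Θ, ∀ i, ∀ x ∈ G.Ωx, ∀ y ∈ G.Ωy, ∀ z ∈ G.Ωz,
    ConcaveOn ℝ (Icc (G.zmin i) (G.zmax i)) fun t => G.UZ i x y (setCoord z i t) θ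
  smooth_X : ContDiffOn ℝ 1 (fun p : ℝ × ℝ × E N => G.UX p.1 p.2.1 p.2.2) G.Ω
  smooth_Y : ∀ θ ∈ G.Θ, ContDiffOn ℝ 1 (fun p : ℝ × ℝ => G.UY p.1 p.2 θ) (G.Ωx ×ˢ G.Ωy)
  smooth_Z : ∀ θ ∈ G.Θ, ∀ i,
    ContDiffOn ℝ 1 (fun p : ℝ × ℝ × E N => G.UZ i p.1 p.2.1 p.2.2 θ) G.Ω
  finite_Θ : G.Θ.Finite

/-- The pseudogradient is `μ`-strongly monotone and `κ`-Lipschitz in `z`, and jointly `C¹`. -/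
structure MonotoneAssumption (μ κ : ℝ) : Prop where
  mu_pos : 0 < μ
  kappa_pos : 0 < κ
  monotone : ∀ θ ∈ G.Θ, ∀ x ∈ G.Ωx, ∀ y ∈ G.Ωy, ∀ z ∈ G.Ωz, ∀ w ∈ G.Ωz,
    μ * ‖z - w‖ ^ 2 ≤ inner ℝ (G.F x y z θ - G.F x y w θ) (z - w)
  lipschitz : ∀ θ ∈ G.Θ, ∀ x ∈ G.Ωx, ∀ y ∈ G.Ωy, ∀ z ∈ G.Ωz, ∀ w ∈ G.Ωz,
    ‖G.F x y z θ - G.F x y w θ‖ ≤ κ * ‖z - w‖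
  smooth : ∀ θ ∈ G.Θ, ContDiffOn ℝ 1 (fun p : ℝ × ℝ × E N => G.F p.1 p.2.1 p.2.2 θ) G.Ω

/-- The zeros of `f₂(·, θ)` on `Ωx`. -/
def zeros (θ : E m) : Set ℝ := {x | x ∈ G.Ωx ∧ G.f₂ x θ = 0}

structure RegularityAssumption : Prop where
  lipschitz_gradB : ∃ L : NNReal,
    LipschitzOnWith L (fun x => derivWithin (fun t => G.B t G.θ₀) G.Ωx x) G.Ωx
  lipschitz_gradf₁ : ∃ L : NNReal,
    LipschitzOnWith L (fun p : ℝ × E N => fderivWithin ℝ (G.f₁ p.1) G.Ωz p.2) (G.Ωy ×ˢ G.Ωz)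
  finite_zeros : ∀ θ ∈ G.Θ, (G.zeros θ).Finite
  definable_F : ∀ θ ∈ G.Θ, IsDefinableSet (G.graphF θ)
  lipschitz_JF : ∃ LF : ℝ, ∀ θ ∈ G.Θ, ∀ x ∈ G.Ωx, ∀ y ∈ G.Ωy, ∀ z ∈ G.Ωz, ∀ w ∈ G.Ωz,
    ‖G.J₁F x y z θ - G.J₁F x y w θ‖ ≤ LF * ‖z - w‖ ∧
    ‖G.J₃F x y z θ - G.J₃F x y w θ‖ ≤ LF * ‖z - w‖

/-! ### The partition of `Ωx` by the zeros of `f₂` -/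

/-- `c = (a, b)` stands for one of the intervals `[a, b]` into which the zeros of `f₂(·, θ)` divide
`Ωx`: its endpoints are zeros or endpoints of `Ωx`, and it has no zero in its interior. -/
def IsCell (θ : E m) (c : ℝ × ℝ) : Prop :=
  c.1 < c.2 ∧ (c.1 = G.xmin ∨ c.1 ∈ G.zeros θ) ∧ (c.2 = G.xmax ∨ c.2 ∈ G.zeros θ) ∧
  c.1 ∈ G.Ωx ∧ c.2 ∈ G.Ωx ∧ ∀ x ∈ Ioo c.1 c.2, G.f₂ x θ ≠ 0

open Classical in
/-- The constant response of the middle-level follower on the interior of the interval `c`, read off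
from the sign of `f₂(·, θ)` there. -/
def φ₁ (θ : E m) (c : ℝ × ℝ) : ℝ :=
  if 0 < G.f₂ ((c.1 + c.2) / 2) θ then G.ymax else G.ymin

/-- The bottom-level response along the interval `c`. -/
def φ₂ (θ : E m) (c : ℝ × ℝ) (x : ℝ) : E N := G.brZ x (G.φ₁ θ c) θ

/-- The leader's utility along the closed interval `c`, with the response of the middle-level
follower kept constant. -/
def UXhat (θ : E m) (c : ℝ × ℝ) (x : ℝ) : ℝ := G.UX x (G.φ₁ θ c) (G.φ₂ θ c x)

/-- Concavity on each interval of the leader's utility with followers' equilibrium inserted. -/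
def ConcavityAssumption : Prop :=
  ∀ θ ∈ G.Θ, ∀ y ∈ G.Ωy, ∀ c, G.IsCell θ c →
    ConcaveOn ℝ (Icc c.1 c.2) fun x => G.UX x y (G.brZ x y θ)

/-! ### The fixed-point map, its Jacobian, and the active regions -/

/-- The pseudogradient step `ω(x, y, z) = z - γ F(x, y, z)`. -/
def ω (γ : ℝ) (x y : ℝ) (z : E N) (θ : E m) : E N := z - γ • G.F x y z θ

/-- Orthogonal projection onto the box `Ωz`. -/
def projZ (w : E N) : E N :=
  WithLp.toLp 2 fun i => max (G.zmin i) (min (G.zmax i) (w i))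

def h (γ : ℝ) (x y : ℝ) (z : E N) (θ : E m) : E N := G.projZ (G.ω γ x y z θ)

/-- The rectangular regions on which the projection is affine; in each coordinate the index says
whether the region lies below, inside, or above the bounds. -/
def region (i : Fin N → SignType) : Set (E N) :=
  {w | ∀ j, (i j = -1 → w j ≤ G.zmin j) ∧ (i j = 0 → w j ∈ Icc (G.zmin j) (G.zmax j)) ∧
    (i j = 1 → G.zmax j ≤ w j)}

/-- The indices `𝒫(x)` of the active regions. -/
def activeRegions (γ : ℝ) (θ : E m) (c : ℝ × ℝ) (x : ℝ) : Set (Fin N → SignType) :=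
  {i | G.ω γ x (G.φ₁ θ c) (G.φ₂ θ c x) θ ∈ G.region i}

/-- The radius `δ(x)` of the largest ball around `ω(x, φ₁(x), φ₂(x))` in the union of the active
regions. -/
def activeRadius (γ : ℝ) (θ : E m) (c : ℝ × ℝ) (x : ℝ) : ℝ :=
  sSup {r : ℝ | 0 ≤ r ∧ Metric.closedBall (G.ω γ x (G.φ₁ θ c) (G.φ₂ θ c x) θ) r ⊆
    ⋃ i ∈ G.activeRegions γ θ c x, G.region i}

/-- `D w` is the diagonal of an element of the Clarke Jacobian at `w` of the projection onto `Ωz`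
(its Jacobian wherever it is differentiable). -/
def IsProjJacobian (D : E N → Fin N → ℝ) : Prop :=
  ∀ w j, D w j ∈ Icc (0 : ℝ) 1 ∧ (w j ∈ Ioo (G.zmin j) (G.zmax j) → D w j = 1) ∧
    (w j < G.zmin j ∨ G.zmax j < w j → D w j = 0)

/-- Multiplication by the diagonal matrix with diagonal `d`. -/
def diagMul (d : Fin N → ℝ) (v : E N) : E N := WithLp.toLp 2 fun j => d j * v j

/-- `J₁h = D(ω) (-γ J₁F)`. -/
def J₁h (D : E N → Fin N → ℝ) (γ : ℝ) (x y : ℝ) (z : E N) (θ : E m) : E N :=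
  diagMul (D (G.ω γ x y z θ)) (-(γ • G.J₁F x y z θ))

/-- The product `J₃h s`, where `J₃h = D(ω) (I - γ J₃F)`. -/
def J₃h (D : E N → Fin N → ℝ) (γ : ℝ) (x y : ℝ) (z : E N) (θ : E m) (s : E N) : E N :=
  diagMul (D (G.ω γ x y z θ)) (s - γ • G.J₃F x y z θ s)

end Game

/-! ### The algorithms -/

/-- The inputs of the algorithm: inner step size, contraction constant, step sizes, tolerances, the
Jacobian of the projection, and initial points for each parameter and interval. -/
structure AlgInput (N m : ℕ) where
  γ : ℝ
  η : ℝ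
  α : ℕ → ℝ
  σ : ℕ → ℝ
  D : E N → Fin N → ℝ
  x₀ : E m → ℝ × ℝ → ℝ
  z₀ : E m → ℝ × ℝ → E N
  s₀ : E m → ℝ × ℝ → E N

namespace Game

variable {N m : ℕ} (G : Game N m) (A : AlgInput N m)

/-! The inner loop, for a fixed leader action `x` and response `y`. -/

/-- The iterates `z, h(z), h(h(z)), …`. -/
def hIter (θ : E m) (x y : ℝ) (z : E N) (n : ℕ) : E N := (fun w => G.h A.γ x y w θ)^[n] z

/-- Phase 1 may stop after `n` steps. -/
def Stop₁ (θ : E m) (x y : ℝ) (z : E N) (σ : ℝ) (n : ℕ) : Prop :=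
  1 ≤ n ∧ ‖G.hIter A θ x y z n - G.hIter A θ x y z (n - 1)‖ ≤ σ

/-- The result of phase 1. -/
def phase₁ (θ : E m) (x y : ℝ) (z : E N) (σ : ℝ) : E N :=
  G.hIter A θ x y z (sInf {n | G.Stop₁ A θ x y z σ n})

/-- The sensitivity iterates of phase 2, started from `z` and `s`. -/
def sIter (θ : E m) (x y : ℝ) (z s : E N) : ℕ → E N
  | 0 => s
  | l + 1 =>
    G.J₁h A.D A.γ x y (G.hIter A θ x y z (l + 1)) θ +
      G.J₃h A.D A.γ x y (G.hIter A θ x y z (l + 1)) θ (sIter θ x y z s l)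

/-- Phase 2 may stop after `l` steps. -/
def Stop₂ (θ : E m) (x y : ℝ) (z : E N) (σ : ℝ) (l : ℕ) : Prop :=
  1 ≤ l ∧ max (A.η ^ l) (∑ j ∈ Finset.range (l + 1),
    A.η ^ (l - j) * ‖G.hIter A θ x y z (j + 1) - G.hIter A θ x y z j‖) ≤ σ

/-- The inner loop; it returns the estimates of the bottom-level response and of its sensitivity. -/
def innerLoop (θ : E m) (x y : ℝ) (z s : E N) (σ : ℝ) : E N × E N :=
  let z' := G.phase₁ A θ x y z σ
  let l := sInf {l | G.Stop₂ A θ x y z' σ l}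
  (G.hIter A θ x y z' l, G.sIter A θ x y z' s l)

/-- Both repeat-loops of the inner loop terminate. -/
def InnerLoopTerminates (θ : E m) (x y : ℝ) (z : E N) (σ : ℝ) : Prop :=
  (∃ n, G.Stop₁ A θ x y z σ n) ∧ ∃ l, G.Stop₂ A θ x y (G.phase₁ A θ x y z σ) σ l

/-- The hypergradient `∇₁U_X + sᵀ ∇₃U_X` at `(x, y, z)`. -/
def hypergradient (x y : ℝ) (z s : E N) : ℝ :=
  derivWithin (fun t => G.UX t y z) G.Ωx x + fderivWithin ℝ (fun w => G.UX x y w) G.Ωz z s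

/-- The iterates `(xᵏ, zᵏ, sᵏ)` of projected hypergradient ascent on the interval `c`. -/
def iter (θ : E m) (c : ℝ × ℝ) : ℕ → ℝ × E N × E N
  | 0 => (A.x₀ θ c, A.z₀ θ c, A.s₀ θ c)
  | k + 1 =>
    let p := iter θ c k
    let r := G.innerLoop A θ p.1 (G.φ₁ θ c) p.2.1 p.2.2 (A.σ k)
    (max c.1 (min c.2 (p.1 + A.α k * G.hypergradient p.1 (G.φ₁ θ c) r.1 r.2)), r.1, r.2)

/-- The iterate `xᵏ` on the interval `c`. -/
def xIter (θ : E m) (c : ℝ × ℝ) (k : ℕ) : ℝ := (G.iter A θ c k).1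

end Game

/-- The leader's attitude: pessimistic for the WDSE, optimistic for the SDSE. -/
inductive Attitude
  | pessimistic
  | optimistic

namespace Game

variable {N m : ℕ} (G : Game N m) (A : AlgInput N m)

/-- The utility assigned by the algorithm to a zero `x` of `f₂(·, θ)`. -/
def zeroUtility (x : ℝ) (θ : E m) : Attitude → ℝ
  | .pessimistic => sInf ((fun y => G.UX x y (G.brZ x y θ)) '' G.Ωy)
  | .optimistic => sSup ((fun y => G.UX x y (G.brZ x y θ)) '' G.Ωy)

/-- `x` is a candidate strategy with utility `u` for the parameter `θ`: it is the limit of the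
iterates on one of the intervals, or a zero of `f₂(·, θ)`. -/
def IsCandidate (att : Attitude) (u x : ℝ) (θ : E m) : Prop :=
  (∃ c, G.IsCell θ c ∧ Tendsto (G.xIter A θ c) atTop (𝓝 x) ∧ u = G.UXhat θ c x) ∨
  (x ∈ G.zeros θ ∧ u = G.zeroUtility x θ att)

/-- `(u, x, θ)` is an output `(U*, x*, θ*)` of the algorithm: a candidate of largest utility among
the candidates for all deception parameters. -/
def IsOutput (att : Attitude) (u x : ℝ) (θ : E m) : Prop :=
  θ ∈ G.Θ ∧ G.IsCandidate A att u x θ ∧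
  ∀ u' x' θ', θ' ∈ G.Θ → G.IsCandidate A att u' x' θ' → u' ≤ u

/-- Admissible inputs: `0 < γ < 2μ/κ²`, the contraction constant
`η = √(1 - γ (2μ - γκ²))`, positive tolerances, nonnegative, nonsummable, square-summable steps with
`∑ αᵏσᵏ < ∞`, and feasible initial points. -/
structure AdmissibleInput (μ κ : ℝ) : Prop where
  gamma_pos : 0 < A.γ
  gamma_lt : A.γ < 2 * μ / κ ^ 2
  eta_eq : A.η = √(1 - A.γ * (2 * μ - A.γ * κ ^ 2))
  sigma_pos : ∀ k, 0 < A.σ k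
  alpha_nonneg : ∀ k, 0 ≤ A.α k
  alpha_nonsummable : ¬ Summable A.α
  alpha_sq_summable : Summable fun k => A.α k ^ 2
  alpha_sigma_summable : Summable fun k => A.α k * A.σ k
  projJacobian : G.IsProjJacobian A.D
  init_x : ∀ θ ∈ G.Θ, ∀ c, G.IsCell θ c → A.x₀ θ c ∈ Icc c.1 c.2
  init_z : ∀ θ ∈ G.Θ, ∀ c, G.IsCell θ c → A.z₀ θ c ∈ G.Ωz

/-- Eventually the tolerance is below the active radius at the iterate. -/
def ToleranceAssumption : Prop :=
  ∀ θ ∈ G.Θ, ∀ c, G.IsCell θ c →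
    ∃ k', ∀ k, k' < k → A.σ k < G.activeRadius A.γ θ c (G.xIter A θ c k)

/-- For all but finitely many iterates on any interval there is exactly one active region. -/
def SingletonAssumption : Prop :=
  ∀ θ ∈ G.Θ, ∀ c, G.IsCell θ c →
    {k | ¬ ∃! i, i ∈ G.activeRegions A.γ θ c (G.xIter A θ c k)}.Finite

end Game

end Deception

end

/-!
Fix a deception parameter `θ` and an interval `c` of the partition, on which the middle-level
response is a constant `y = φ₁`. Strong monotonicity makes the projected pseudogradient step
`h(x, y, ·)` a contraction with factor `η`, its fixed points are the bottom-level Nash equilibria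
(`Hypotheses.mem_BRZ_iff`), and so the equilibrium `φ₂(x)` is unique, Lipschitz in `x`, and the
limit of the inner iterates.

Where `ω(x, y, φ₂(x))` lies in the interior of a region on which the projection is affine, `φ₂` is
differentiable, and its derivative is the fixed point of the linearized equation
`s = J₁h + J₃h s` (`Hypotheses.hasDerivWithinAt_brZ`); here `‖J₃h‖ ≤ η` also at boundary points of
the box. The inner loop returns the equilibrium and this sensitivity with errors of order `σᵏ`
(`Hypotheses.exists_innerLoop_error_le`). The condition `σᵏ < δ(xᵏ)` does not keep every iterate of
the second phase in the active region: the initial distance to the equilibrium is only bounded by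
`η σᵏ / (1 - η)`. But only a number of iterates independent of `k` can be outside, and their
effect on the sensitivity is damped by `η ^ ℓ ≤ σᵏ` when the loop stops.

Hence the computed hypergradient is the derivative of the concave function `UXhat` up to `O(σᵏ)`.
Projected ascent with such errors, `∑ αᵏσᵏ < ∞`, is quasi-Fejér monotone with respect to every
maximizer, so the iterates converge to a maximizer of `UXhat` on the interval
(`projectedAscent_tendsto`, `Hypotheses.xIter_tendsto`).

The middle-level response is `{φ₁}` off the zeros of `f₂` and all of `Ωy` at a zero. So the
optimistic and the pessimistic utility equal `UXhat` off the zeros, while at a zero they are the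
utilities that the algorithm assigns to it; the candidates dominate all values of these utilities.
In the optimistic version, a limit at a zero of `f₂` has a utility which is itself a response value
there. In the pessimistic version it is a limit of pessimistic utilities along the interior of the
interval (`Hypotheses.tendsto_worst`), which gives the supremum; it is attained at the limit point
if the pessimistic utility is upper semicontinuous there, and a maximum point of the pessimistic
utility is trivially a point of upper semicontinuity.
-/

open Set Filter Topology

namespace Deception

/-! ### Concave functions of one variable -/

theorem _root_.ConcaveOn.le_add_mul_of_hasDerivWithinAt {s : Set ℝ} {f : ℝ → ℝ} {d p t : ℝ}
    (hf : ConcaveOn ℝ s f) (hp : p ∈ s) (ht : t ∈ s) (hd : HasDerivWithinAt f d s p) :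
    f t ≤ f p + d * (t - p) := by
  rcases lt_trichotomy p t with h | rfl | h
  · have := hf.slope_le_of_hasDerivWithinAt hp ht h hd
    rw [slope_def_field, div_le_iff₀ (by linarith)] at this
    linarith
  · simp
  · have := hf.le_slope_of_hasDerivWithinAt ht hp h hd
    rw [slope_def_field, le_div_iff₀ (by linarith)] at this
    linarith

/-- The maximizers of a concave function on an interval are the fixed points of the projected
gradient step, whatever the step size. -/
theorem isMaxOn_Icc_iff_eq_clamp {a b p d γ : ℝ} {f : ℝ → ℝ} (hγ : 0 < γ)
    (hf : ConcaveOn ℝ (Icc a b) f) (hp : p ∈ Icc a b) (hd : HasDerivWithinAt f d (Icc a b) p) :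
    (∀ t ∈ Icc a b, f t ≤ f p) ↔ p = max a (min b (p + γ * d)) := by
  have hab : a ≤ b := hp.1.trans hp.2
  constructor
  · intro h
    have key : ∀ t ∈ Icc a b, d * (t - p) ≤ 0 := by
      intro t ht
      have hmax : IsLocalMaxOn f (Icc a b) p :=
        Filter.eventually_of_mem self_mem_nhdsWithin h
      have := hmax.hasFDerivWithinAt_nonpos hd.hasFDerivWithinAt
        (sub_mem_posTangentConeAt_of_segment_subset ((convex_Icc a b).segment_subset hp ht))
      simpa [mul_comm] using this
    have ha := key a (left_mem_Icc.2 hab)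
    have hb := key b (right_mem_Icc.2 hab)
    rcases lt_trichotomy d 0 with h0 | h0 | h0
    · have : p = a := le_antisymm (by nlinarith [hp.1]) hp.1
      subst this
      rw [min_eq_right (by nlinarith), max_eq_left (by nlinarith)]
    · subst h0
      simp [hp.1, hp.2]
    · have : p = b := le_antisymm hp.2 (by nlinarith)
      subst this
      rw [min_eq_left (by nlinarith), max_eq_right hab]
  · intro h t ht
    refine (hf.le_add_mul_of_hasDerivWithinAt hp ht hd).trans ?_
    have : d * (t - p) ≤ 0 := by
      rcases lt_trichotomy d 0 with h0 | h0 | h0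
      · have hpa : p = a := by
          have h1 : p + γ * d < p := by nlinarith
          by_contra hne
          have h2 : a < p := lt_of_le_of_ne hp.1 (Ne.symm hne)
          have : max a (min b (p + γ * d)) < p :=
            max_lt h2 ((min_le_right _ _).trans_lt h1)
          linarith
        nlinarith [ht.1]
      · simp [h0]
      · have hpb : p = b := by
          have h1 : p < p + γ * d := by nlinarith [mul_pos hγ h0]
          by_contra hne
          have h2 : p < b := lt_of_le_of_ne hp.2 hne
          have : p < max a (min b (p + γ * d)) :=
            (lt_min h2 h1).trans_le (le_max_right _ _)
          linarith
        nlinarith [ht.2]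
    linarith

theorem abs_clamp_sub_clamp_le (a b s t : ℝ) :
    |max a (min b s) - max a (min b t)| ≤ |s - t| := by
  have h1 := abs_max_sub_max_le_max a (min b s) a (min b t)
  have h2 := abs_min_sub_min_le_max b s b t
  simp only [sub_self, abs_zero] at h1 h2
  rw [max_eq_right (abs_nonneg (min b s - min b t))] at h1
  rw [max_eq_right (abs_nonneg (s - t))] at h2
  exact h1.trans h2

theorem clamp_eq_self {a b t : ℝ} (ht : t ∈ Icc a b) : max a (min b t) = t := by
  rw [min_eq_right ht.2, max_eq_right ht.1]

theorem clamp_mem {a b : ℝ} (hab : a ≤ b) (t : ℝ) : max a (min b t) ∈ Icc a b :=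
  ⟨le_max_left _ _, max_le hab (min_le_left _ _)⟩

/-! ### Convergence of inexact projected gradient ascent on an interval -/

/-- Deterministic Robbins–Siegmund lemma: a quasi-Fejér monotone sequence converges, and its
decrements are summable. -/
theorem quasiFejer {a b c : ℕ → ℝ} (ha : ∀ k, 0 ≤ a k) (hb : ∀ k, 0 ≤ b k) (hc : ∀ k, 0 ≤ c k)
    (hcs : Summable c) (h : ∀ k, a (k + 1) ≤ a k - b k + c k) :
    (∃ l, Tendsto a atTop (𝓝 l)) ∧ Summable b := by
  constructor
  · set v : ℕ → ℝ := fun k => a k - ∑ j ∈ Finset.range k, c j with hv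
    have hanti : Antitone v := antitone_nat_of_succ_le fun k => by
      simp only [hv, Finset.sum_range_succ]
      linarith [h k, hb k]
    have hbdd : BddBelow (range v) := by
      refine ⟨-∑' j, c j, ?_⟩
      rintro _ ⟨k, rfl⟩
      have := hcs.sum_le_tsum (Finset.range k) fun i _ => hc i
      simp only [hv]
      linarith [ha k]
    have h1 := tendsto_atTop_ciInf hanti hbdd
    have h2 := hcs.hasSum.tendsto_sum_nat
    refine ⟨_, (h1.add h2).congr fun k => ?_⟩
    simp [hv]
  · refine summable_of_sum_range_le (c := a 0 + ∑' j, c j) hb fun n => ?_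
    have h1 : ∀ n, ∑ j ∈ Finset.range n, b j ≤ a 0 - a n + ∑ j ∈ Finset.range n, c j := by
      intro n
      induction n with
      | zero => simp
      | succ n ih =>
        rw [Finset.sum_range_succ, Finset.sum_range_succ]
        linarith [h n]
    have := hcs.sum_le_tsum (Finset.range n) fun i _ => hc i
    linarith [h1 n, ha n]

theorem frequently_lt_of_summable_mul {α e : ℕ → ℝ} (hα : ∀ k, 0 ≤ α k) (hαs : ¬ Summable α)
    (hs : Summable fun k => α k * e k) {ε : ℝ} (hε : 0 < ε) :
    ∃ᶠ k in atTop, e k < ε := by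
  by_contra hcon
  rw [not_frequently] at hcon
  obtain ⟨K, hK⟩ := eventually_atTop.1 hcon
  refine hαs ((summable_nat_add_iff K).1 ?_)
  refine Summable.of_nonneg_of_le (fun k => hα _) (fun k => ?_)
    (((summable_nat_add_iff K).2 hs).mul_left ε⁻¹)
  have h1 := not_lt.1 (hK (k + K) (Nat.le_add_left _ _))
  have h2 := mul_le_mul_of_nonneg_left h1 (hα (k + K))
  calc α (k + K) = ε⁻¹ * (α (k + K) * ε) := by field_simp
    _ ≤ _ := by gcongr

/-- Projected gradient ascent on an interval with step sizes `α` and gradient errors of order `σ`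
converges to a maximizer of a concave function; the gradient need only exist, and the error bounds
hold, along the tail of the iterates. -/
theorem projectedAscent_tendsto {a b : ℝ} (hab : a ≤ b) {U : ℝ → ℝ}
    (hconc : ConcaveOn ℝ (Icc a b) U) (hcont : ContinuousOn U (Icc a b))
    {x g α σ : ℕ → ℝ} {C M : ℝ} (hC : 0 ≤ C) (hx : ∀ k, x k ∈ Icc a b)
    (hstep : ∀ k, x (k + 1) = max a (min b (x k + α k * g k)))
    (hgrad : ∀ᶠ k in atTop, ∃ d, HasDerivWithinAt U d (Icc a b) (x k) ∧
      |g k - d| ≤ C * σ k ∧ |g k| ≤ M)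
    (hα : ∀ k, 0 ≤ α k) (hσ : ∀ k, 0 ≤ σ k) (hα1 : ¬ Summable α)
    (hα2 : Summable fun k => α k ^ 2) (hασ : Summable fun k => α k * σ k) :
    ∃ l ∈ Icc a b, Tendsto x atTop (𝓝 l) ∧ ∀ t ∈ Icc a b, U t ≤ U l := by
  obtain ⟨K, hK⟩ := eventually_atTop.1 hgrad
  obtain ⟨m, hm, hmax⟩ := isCompact_Icc.exists_isMaxOn (nonempty_Icc.2 hab) hcont
  have hmax' : ∀ t ∈ Icc a b, U t ≤ U m := fun t ht => hmax ht
  -- every maximizer gives a quasi-Fejér inequality for the squared distance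
  have hfejer : ∀ p ∈ Icc a b, (∀ t ∈ Icc a b, U t ≤ U p) →
      (∃ l, Tendsto (fun k => (x (k + K) - p) ^ 2) atTop (𝓝 l)) ∧
      Summable fun k => 2 * (α (k + K) * (U p - U (x (k + K)))) := by
    intro p hp hpmax
    refine quasiFejer
      (c := fun k => 2 * (C * (b - a)) * (α (k + K) * σ (k + K)) + M ^ 2 * α (k + K) ^ 2)
      (fun k => sq_nonneg _) (fun k => ?_) (fun k => ?_) ?_ (fun k => ?_)
    · have := mul_nonneg (hα (k + K)) (sub_nonneg.2 (hpmax _ (hx (k + K))))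
      positivity
    · have h1 := mul_nonneg (hα (k + K)) (hσ (k + K))
      have h2 := mul_nonneg hC (sub_nonneg.2 hab)
      positivity
    · exact (((summable_nat_add_iff K).2 hασ).mul_left _).add
        (((summable_nat_add_iff K).2 hα2).mul_left _)
    · obtain ⟨d, hd, hgd, hgM⟩ := hK (k + K) (Nat.le_add_left _ _)
      have hxk := hx (k + K)
      have htan := hconc.le_add_mul_of_hasDerivWithinAt hxk hp hd
      have hnext : x (k + 1 + K) =
          max a (min b (x (k + K) + α (k + K) * g (k + K))) := by
        rw [show k + 1 + K = k + K + 1 by ring]; exact hstep _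
      have hA := hα (k + K)
      have hS := hσ (k + K)
      generalize x (k + K) = X at *
      generalize g (k + K) = Γ at *
      generalize α (k + K) = A at *
      generalize σ (k + K) = S at *
      have hproj := abs_clamp_sub_clamp_le a b (X + A * Γ) p
      rw [clamp_eq_self hp, ← hnext] at hproj
      have h1 : (x (k + 1 + K) - p) ^ 2 ≤ (X + A * Γ - p) ^ 2 := sq_le_sq.2 hproj
      have h2 : Γ ^ 2 ≤ M ^ 2 := by
        have := sq_abs Γ
        have := abs_nonneg Γ
        nlinarith
      have h3 : (Γ - d) * (X - p) ≤ C * S * (b - a) := by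
        have h4 : |X - p| ≤ b - a := by
          rw [abs_le]; constructor <;> linarith [hxk.1, hxk.2, hp.1, hp.2]
        calc (Γ - d) * (X - p) ≤ |Γ - d| * |X - p| := by
              rw [← abs_mul]; exact le_abs_self _
          _ ≤ _ := mul_le_mul hgd h4 (abs_nonneg _) (by positivity)
      have h4 : A * ((Γ - d) * (X - p)) ≤ A * (C * S * (b - a)) :=
        mul_le_mul_of_nonneg_left h3 hA
      have h5 : A ^ 2 * Γ ^ 2 ≤ A ^ 2 * M ^ 2 := mul_le_mul_of_nonneg_left h2 (sq_nonneg A)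
      have h6 := mul_le_mul_of_nonneg_left htan hA
      nlinarith
  -- some subsequence of values tends to the maximum
  have hfreq : ∀ n : ℕ, ∃ k, n ≤ k ∧ U m - U (x (k + K)) < 1 / ((n : ℝ) + 1) := by
    intro n
    have hs := (hfejer m hm hmax').2.mul_left (1 / 2)
    have hs' : Summable fun k => α (k + K) * (U m - U (x (k + K))) :=
      hs.congr fun k => by ring
    have := frequently_lt_of_summable_mul (fun k => hα (k + K))
      (fun h => hα1 ((summable_nat_add_iff K).1 h)) hs'
      (show (0 : ℝ) < 1 / ((n : ℝ) + 1) by positivity)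
    exact frequently_atTop.1 this n
  choose κ hκn hκ using hfreq
  obtain ⟨l, hl, φ, hφ, hlim⟩ := isCompact_Icc.tendsto_subseq fun n => hx (κ n + K)
  have hκφ : Tendsto (κ ∘ φ) atTop atTop :=
    tendsto_atTop_mono (fun n => (hφ.id_le n).trans (hκn _)) tendsto_id
  have hUl : U m ≤ U l := by
    have h1 : Tendsto (fun n => U (x (κ (φ n) + K))) atTop (𝓝 (U l)) :=
      (hcont l hl).tendsto.comp
        (tendsto_nhdsWithin_iff.2 ⟨hlim, Eventually.of_forall fun n => hx _⟩)
    have h2 : Tendsto (fun n => U (x (κ (φ n) + K)) + 1 / ((φ n : ℝ) + 1)) atTop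
        (𝓝 (U l + 0)) :=
      h1.add (tendsto_one_div_add_atTop_nhds_zero_nat.comp hφ.tendsto_atTop)
    rw [add_zero] at h2
    exact ge_of_tendsto' h2 fun n => by linarith [hκ (φ n)]
  have hlmax : ∀ t ∈ Icc a b, U t ≤ U l := fun t ht => (hmax' t ht).trans hUl
  refine ⟨l, hl, ?_, hlmax⟩
  obtain ⟨r, hr⟩ := (hfejer l hl hlmax).1
  have hr0 : r = 0 := by
    have h1 := hr.comp hκφ
    have h2 : Tendsto (fun n => (x (κ (φ n) + K) - l) ^ 2) atTop (𝓝 ((l - l) ^ 2)) :=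
      (hlim.sub_const l).pow 2
    rw [sub_self, zero_pow two_ne_zero] at h2
    exact tendsto_nhds_unique h1 h2
  subst hr0
  rw [← tendsto_add_atTop_iff_nat K, tendsto_iff_norm_sub_tendsto_zero]
  have h3 := (Real.continuous_sqrt.tendsto 0).comp hr
  rw [Real.sqrt_zero] at h3
  refine h3.congr fun k => ?_
  simp [Real.sqrt_sq_eq_abs]

/-! ### A perturbed linear recursion -/

theorem exists_nat_mul_pow_le {η : ℝ} (h0 : 0 ≤ η) (h1 : η < 1) :
    ∃ K, 0 ≤ K ∧ ∀ n : ℕ, (n : ℝ) * η ^ n ≤ K := by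
  obtain ⟨K, hK⟩ := (tendsto_self_mul_const_pow_of_lt_one h0 h1).bddAbove_range
  exact ⟨K, by simpa using hK ⟨0, rfl⟩, fun n => hK ⟨n, rfl⟩⟩

/-- An error sequence that is a priori bounded and, from index `J` on, contracts with factor `η` up
to a perturbation `C σ η ^ (j + 1)` is of order `σ` at every index `l` with `η ^ l ≤ σ`. The bound
does not depend on the sequence, nor on `σ`. -/
theorem exists_forall_perturbed_le {η : ℝ} (h0 : 0 ≤ η) (h1 : η < 1) {J : ℕ}
    (hJ : η = 0 → J = 0) {M C : ℝ} (hM : 0 ≤ M) (hC : 0 ≤ C) :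
    ∃ K, 0 ≤ K ∧ ∀ (e : ℕ → ℝ) (σ : ℝ) (l : ℕ), 0 ≤ σ → (∀ j, e j ≤ M) →
      (∀ j, J ≤ j → e (j + 1) ≤ η * e j + C * σ * η ^ (j + 1)) → η ^ l ≤ σ → e l ≤ K * σ := by
  obtain ⟨K₁, hK₁, hK₁'⟩ := exists_nat_mul_pow_le h0 h1
  obtain ⟨K₂, hK₂, hK₂'⟩ : ∃ K, 0 ≤ K ∧ ∀ l : ℕ, η ^ (l - J) ≤ K * η ^ l := by
    rcases h0.eq_or_lt with h | h
    · refine ⟨1, zero_le_one, fun l => ?_⟩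
      rw [hJ h.symm]; simp
    · refine ⟨(η ^ J)⁻¹, by positivity, fun l => ?_⟩
      rw [inv_mul_eq_div, le_div_iff₀ (by positivity), ← pow_add]
      exact pow_le_pow_of_le_one h0 h1.le (by omega)
  refine ⟨M * K₂ + C * K₁, by positivity, fun e σ l hσ hb hrec hl => ?_⟩
  have key : ∀ j, e j ≤ M * η ^ (j - J) + C * σ * (j * η ^ j) := by
    intro j
    induction j with
    | zero => simpa using hb 0
    | succ j ih =>
      by_cases hj : J ≤ j
      · refine (hrec j hj).trans ?_
        have := mul_le_mul_of_nonneg_left ih h0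
        rw [show j + 1 - J = (j - J) + 1 by omega]
        push_cast
        calc _ ≤ η * (M * η ^ (j - J) + C * σ * (j * η ^ j)) + C * σ * η ^ (j + 1) := by
              gcongr
          _ = _ := by ring
      · have : j + 1 - J = 0 := by omega
        rw [this, pow_zero, mul_one]
        have : 0 ≤ C * σ * (((j + 1 : ℕ) : ℝ) * η ^ (j + 1)) := by positivity
        linarith [hb (j + 1)]
  calc e l ≤ M * η ^ (l - J) + C * σ * (l * η ^ l) := key l
    _ ≤ M * (K₂ * σ) + C * σ * K₁ := by
        gcongr
        · exact (hK₂' l).trans (by gcongr)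
        · exact hK₁' l
    _ = _ := by ring

/-! ### Derivatives of contractions -/

/-- Contractivity bounds on differences along two feasible directions pass to the derivative, even
at a boundary point. -/
theorem norm_map_sub_le_of_hasFDerivWithinAt {V W : Type*} [NormedAddCommGroup V] [NormedSpace ℝ V]
    [NormedAddCommGroup W] [NormedSpace ℝ W] {f : V → W} {f' : V →L[ℝ] W} {s : Set V} {z u v : V}
    {η : ℝ} (hs : Convex ℝ s) (hf : HasFDerivWithinAt f f' s z) (hz : z ∈ s) (hu : z + u ∈ s)
    (hv : z + v ∈ s) (hlip : ∀ p ∈ s, ∀ q ∈ s, ‖f p - f q‖ ≤ η * ‖p - q‖) :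
    ‖f' (u - v)‖ ≤ η * ‖u - v‖ := by
  have hmem : ∀ w, z + w ∈ s → ∀ n : ℕ, z + ((n : ℝ) + 1)⁻¹ • w ∈ s := by
    intro w hw n
    have h1 : ((n : ℝ) + 1)⁻¹ ≤ 1 := inv_le_one_of_one_le₀ (by linarith [n.cast_nonneg (α := ℝ)])
    have := hs.add_smul_mem hz hw ⟨(by positivity : (0 : ℝ) ≤ ((n : ℝ) + 1)⁻¹), h1⟩
    exact this
  have hlim : ∀ w, z + w ∈ s →
      Tendsto (fun n : ℕ => ((n : ℝ) + 1) • (f (z + ((n : ℝ) + 1)⁻¹ • w) - f z)) atTop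
        (𝓝 (f' w)) := by
    intro w hw
    refine hf.lim (d := fun n : ℕ => ((n : ℝ) + 1)⁻¹ • w)
      (c := fun n : ℕ => (n : ℝ) + 1) ?_ (Eventually.of_forall (hmem w hw)) ?_
    · have : Tendsto (fun n : ℕ => ((n : ℝ) + 1)) atTop atTop :=
        tendsto_atTop_add_const_right _ _ tendsto_natCast_atTop_atTop
      simpa using (tendsto_inv_atTop_zero.comp this).smul_const w
    · refine tendsto_const_nhds.congr fun n => ?_
      have : ((n : ℝ) + 1) ≠ 0 := by positivity
      rw [smul_smul, mul_inv_cancel₀ this, one_smul]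
  have h1 := ((hlim u hu).sub (hlim v hv)).norm
  rw [← map_sub] at h1
  refine le_of_tendsto' h1 fun n => ?_
  have hn : (0 : ℝ) < (n : ℝ) + 1 := by positivity
  rw [← smul_sub, sub_sub_sub_cancel_right, norm_smul, Real.norm_of_nonneg hn.le]
  refine (mul_le_mul_of_nonneg_left (hlip _ (hmem u hu n) _ (hmem v hv n)) hn.le).trans_eq ?_
  rw [add_sub_add_left_eq_sub, ← smul_sub, norm_smul, norm_inv, Real.norm_of_nonneg hn.le]
  field_simp

/-! ### Continuously differentiable functions on compact convex sets -/

theorem exists_lipschitz_of_contDiffOn {V W : Type*} [NormedAddCommGroup V] [NormedSpace ℝ V]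
    [NormedAddCommGroup W] [NormedSpace ℝ W] {f : V → W} {s : Set V} (hf : ContDiffOn ℝ 1 f s)
    (hs : Convex ℝ s) (hc : IsCompact s) (hu : UniqueDiffOn ℝ s) :
    ∃ L, 0 ≤ L ∧ (∀ x ∈ s, ‖fderivWithin ℝ f s x‖ ≤ L) ∧
      ∀ x ∈ s, ∀ y ∈ s, ‖f x - f y‖ ≤ L * ‖x - y‖ := by
  obtain ⟨L, hL⟩ := hc.exists_bound_of_continuousOn (hf.continuousOn_fderivWithin hu le_rfl)
  refine ⟨max L 0, le_max_right _ _, fun x hx => (hL x hx).trans (le_max_left _ _),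
    fun x hx y hy => ?_⟩
  exact hs.norm_image_sub_le_of_norm_fderivWithin_le (hf.differentiableOn one_ne_zero)
    (fun x hx => (hL x hx).trans (le_max_left _ _)) hy hx

theorem hasDerivWithinAt_partial_fst {V W : Type*} [NormedAddCommGroup V] [NormedSpace ℝ V]
    [NormedAddCommGroup W] [NormedSpace ℝ W] {f : ℝ × V → W} {T : ℝ × V →L[ℝ] W} {s : Set ℝ}
    {t : Set V} {x : ℝ} {z : V} (hz : z ∈ t) (hT : HasFDerivWithinAt f T (s ×ˢ t) (x, z)) :
    HasDerivWithinAt (fun r => f (r, z)) (T (1, 0)) s x := by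
  have h1 : HasDerivWithinAt (fun r : ℝ => (r, z)) ((1 : ℝ), (0 : V)) s x :=
    (hasDerivWithinAt_id x s).prodMk (hasDerivWithinAt_const x s z)
  exact HasFDerivWithinAt.comp_hasDerivWithinAt (t := s ×ˢ t) x hT h1
    fun r (hr : r ∈ s) => ⟨hr, hz⟩

theorem hasFDerivWithinAt_partial_snd {V W : Type*} [NormedAddCommGroup V] [NormedSpace ℝ V]
    [NormedAddCommGroup W] [NormedSpace ℝ W] {f : ℝ × V → W} {T : ℝ × V →L[ℝ] W} {s : Set ℝ}
    {t : Set V} {x : ℝ} {z : V} (hx : x ∈ s) (hT : HasFDerivWithinAt f T (s ×ˢ t) (x, z)) :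
    HasFDerivWithinAt (fun w => f (x, w)) (T.comp (ContinuousLinearMap.inr ℝ ℝ V)) t z := by
  have h1 : HasFDerivWithinAt (fun w : V => (x, w)) (ContinuousLinearMap.inr ℝ ℝ V) t z :=
    (hasFDerivWithinAt_const x z t).prodMk (hasFDerivWithinAt_id z t)
  exact hT.comp z h1 fun r hr => ⟨hx, hr⟩

/-! ### The box of bottom-level profiles and its projection -/

theorem norm_le_norm_of_abs_le {N : ℕ} {v w : E N} (h : ∀ j, |v j| ≤ |w j|) : ‖v‖ ≤ ‖w‖ := by
  rw [EuclideanSpace.norm_eq, EuclideanSpace.norm_eq]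
  refine Real.sqrt_le_sqrt (Finset.sum_le_sum fun j _ => ?_)
  simp only [Real.norm_eq_abs]
  exact pow_le_pow_left₀ (abs_nonneg _) (h j) 2

namespace Game

variable {N m : ℕ} {G : Game N m}

@[simp] theorem setCoord_apply (z : E N) (i : Fin N) (t : ℝ) (j : Fin N) :
    setCoord z i t j = if j = i then t else z j := by
  simp [setCoord, Function.update_apply]

theorem setCoord_self (z : E N) (i : Fin N) : setCoord z i (z i) = z := by
  ext j
  rw [setCoord_apply]
  split_ifs with h
  · rw [h]
  · rfl

theorem setCoord_mem {z : E N} (hz : z ∈ G.Ωz) {i : Fin N} {t : ℝ}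
    (ht : t ∈ Icc (G.zmin i) (G.zmax i)) : setCoord z i t ∈ G.Ωz := by
  intro j
  rw [setCoord_apply]
  split_ifs with h
  · rw [h]; exact ht
  · exact hz j

theorem contDiff_setCoord (z : E N) (i : Fin N) : ContDiff ℝ 1 fun t => setCoord z i t := by
  rw [contDiff_euclidean]
  intro j
  simp only [setCoord_apply]
  split_ifs
  · exact contDiff_id
  · exact contDiff_const

variable (G) in
theorem convex_Ωz : Convex ℝ G.Ωz := by
  intro z hz w hw a b ha hb hab j
  exact convex_Icc (G.zmin j) (G.zmax j) (hz j) (hw j) ha hb hab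

variable (G) in
theorem isCompact_Ωz : IsCompact G.Ωz := by
  have h1 : IsCompact (Set.pi univ fun i => Icc (G.zmin i) (G.zmax i)) :=
    isCompact_univ_pi fun i => isCompact_Icc
  convert h1.image (PiLp.continuous_toLp 2 fun _ : Fin N => ℝ) using 1
  ext z
  constructor
  · intro hz
    exact ⟨fun i => z i, fun i _ => hz i, rfl⟩
  · rintro ⟨w, hw, rfl⟩ i
    exact hw i (mem_univ i)

theorem uniqueDiffOn_Ωz (hN : G.Nondegenerate) : UniqueDiffOn ℝ G.Ωz := by
  refine uniqueDiffOn_convex G.convex_Ωz ?_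
  have hopen : IsOpen {z : E N | ∀ i, z i ∈ Ioo (G.zmin i) (G.zmax i)} := by
    rw [ofPred_forall]
    exact isOpen_iInter_of_finite fun i => isOpen_Ioo.preimage (by fun_prop)
  refine ⟨WithLp.toLp 2 fun i => (G.zmin i + G.zmax i) / 2, ?_⟩
  have hsub : {z : E N | ∀ i, z i ∈ Ioo (G.zmin i) (G.zmax i)} ⊆ G.Ωz :=
    fun z hz i => Ioo_subset_Icc_self (hz i)
  refine interior_maximal hsub hopen fun i => ?_
  have := hN.2.2.2.2 i
  constructor
  · show G.zmin i < (G.zmin i + G.zmax i) / 2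
    linarith
  · show (G.zmin i + G.zmax i) / 2 < G.zmax i
    linarith

theorem uniqueDiffOn_Ωx (hN : G.Nondegenerate) : UniqueDiffOn ℝ G.Ωx :=
  uniqueDiffOn_Icc hN.2.2.1

theorem uniqueDiffOn_Ωy (hN : G.Nondegenerate) : UniqueDiffOn ℝ G.Ωy :=
  uniqueDiffOn_Icc hN.2.2.2.1

theorem uniqueDiffOn_Ω (hN : G.Nondegenerate) : UniqueDiffOn ℝ G.Ω :=
  (uniqueDiffOn_Ωx hN).prod ((uniqueDiffOn_Ωy hN).prod (uniqueDiffOn_Ωz hN))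

variable (G) in
theorem isCompact_Ω : IsCompact G.Ω :=
  isCompact_Icc.prod (isCompact_Icc.prod G.isCompact_Ωz)

variable (G) in
theorem convex_Ω : Convex ℝ G.Ω :=
  (convex_Icc _ _).prod ((convex_Icc _ _).prod G.convex_Ωz)

theorem projZ_mem (hN : G.Nondegenerate) (w : E N) : G.projZ w ∈ G.Ωz :=
  fun i => clamp_mem (hN.2.2.2.2 i).le (w i)

theorem norm_projZ_sub_le (v w : E N) : ‖G.projZ v - G.projZ w‖ ≤ ‖v - w‖ :=
  norm_le_norm_of_abs_le fun j => abs_clamp_sub_clamp_le _ _ (v j) (w j)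

theorem norm_diagMul_le {d : Fin N → ℝ} (hd : ∀ j, d j ∈ Icc (0 : ℝ) 1) (v : E N) :
    ‖diagMul d v‖ ≤ ‖v‖ := by
  refine norm_le_norm_of_abs_le fun j => ?_
  change |d j * v j| ≤ |v j|
  rw [abs_mul, abs_of_nonneg (hd j).1]
  exact mul_le_of_le_one_left (abs_nonneg _) (hd j).2

theorem diagMul_sub (d : Fin N → ℝ) (v w : E N) :
    diagMul d (v - w) = diagMul d v - diagMul d w := by
  ext j
  exact mul_sub (d j) (v j) (w j)

theorem diagMul_smul (d : Fin N → ℝ) (r : ℝ) (v : E N) :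
    diagMul d (r • v) = r • diagMul d v := by
  ext j
  exact mul_left_comm (d j) r (v j)

theorem diagMul_add (d : Fin N → ℝ) (v w : E N) :
    diagMul d (v + w) = diagMul d v + diagMul d w := by
  ext j
  exact mul_add (d j) (v j) (w j)

/-! ### The pseudogradient step and the bottom-level equilibrium -/

/-- The assumptions on the game and on the inputs of the algorithm that do not refer to the
iterates. -/
structure Hypotheses (G : Game N m) (A : AlgInput N m) (μ κ : ℝ) : Prop where
  nondeg : G.Nondegenerate
  util : G.UtilityAssumption
  mono : G.MonotoneAssumption μ κ
  reg : G.RegularityAssumption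
  conc : G.ConcavityAssumption
  input : G.AdmissibleInput A μ κ

namespace Hypotheses

variable {A : AlgInput N m} {μ κ : ℝ} (H : G.Hypotheses A μ κ) {θ : E m} {x y : ℝ}

include H

theorem sq_norm_ω_sub_le (hθ : θ ∈ G.Θ) (hx : x ∈ G.Ωx) (hy : y ∈ G.Ωy) {z w : E N}
    (hz : z ∈ G.Ωz) (hw : w ∈ G.Ωz) :
    ‖G.ω A.γ x y z θ - G.ω A.γ x y w θ‖ ^ 2 ≤
      (1 - A.γ * (2 * μ - A.γ * κ ^ 2)) * ‖z - w‖ ^ 2 := by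
  have h1 := H.mono.monotone θ hθ x hx y hy z hz w hw
  have h2 := H.mono.lipschitz θ hθ x hx y hy z hz w hw
  have h3 : G.ω A.γ x y z θ - G.ω A.γ x y w θ =
      (z - w) - A.γ • (G.F x y z θ - G.F x y w θ) := by
    simp only [ω, smul_sub]; abel
  rw [h3, norm_sub_sq_real, inner_smul_right, norm_smul, mul_pow, Real.norm_eq_abs, sq_abs,
    real_inner_comm]
  have h4 : ‖G.F x y z θ - G.F x y w θ‖ ^ 2 ≤ (κ * ‖z - w‖) ^ 2 :=
    pow_le_pow_left₀ (norm_nonneg _) h2 2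
  have h5 := mul_le_mul_of_nonneg_left h1 H.input.gamma_pos.le
  have h6 := mul_le_mul_of_nonneg_left h4 (sq_nonneg A.γ)
  nlinarith

theorem eta_nonneg : 0 ≤ A.η := by
  rw [H.input.eta_eq]; exact Real.sqrt_nonneg _

theorem eta_lt_one : A.η < 1 := by
  rw [H.input.eta_eq, Real.sqrt_lt' one_pos]
  have h1 := H.input.gamma_lt
  have h2 := H.mono.kappa_pos
  rw [lt_div_iff₀ (by positivity)] at h1
  have := mul_pos H.input.gamma_pos (sub_pos.2 h1)
  linarith

theorem norm_ω_sub_le (hθ : θ ∈ G.Θ) (hx : x ∈ G.Ωx) (hy : y ∈ G.Ωy) {z w : E N}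
    (hz : z ∈ G.Ωz) (hw : w ∈ G.Ωz) :
    ‖G.ω A.γ x y z θ - G.ω A.γ x y w θ‖ ≤ A.η * ‖z - w‖ := by
  have h1 := Real.sqrt_le_sqrt (H.sq_norm_ω_sub_le hθ hx hy hz hw)
  rwa [Real.sqrt_sq (norm_nonneg _), Real.sqrt_mul' _ (sq_nonneg _), Real.sqrt_sq (norm_nonneg _),
    ← H.input.eta_eq] at h1

theorem h_mem (z : E N) : G.h A.γ x y z θ ∈ G.Ωz := projZ_mem H.nondeg _

theorem norm_h_sub_le (hθ : θ ∈ G.Θ) (hx : x ∈ G.Ωx) (hy : y ∈ G.Ωy) {z w : E N}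
    (hz : z ∈ G.Ωz) (hw : w ∈ G.Ωz) :
    ‖G.h A.γ x y z θ - G.h A.γ x y w θ‖ ≤ A.η * ‖z - w‖ :=
  (norm_projZ_sub_le _ _).trans (H.norm_ω_sub_le hθ hx hy hz hw)

theorem exists_fixedPoint (hθ : θ ∈ G.Θ) (hx : x ∈ G.Ωx) (hy : y ∈ G.Ωy) :
    ∃ z ∈ G.Ωz, G.h A.γ x y z θ = z := by
  have hc : ContractingWith ⟨A.η, H.eta_nonneg⟩ fun z => G.h A.γ x y (G.projZ z) θ := by
    refine ⟨H.eta_lt_one, LipschitzWith.of_dist_le_mul fun z w => ?_⟩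
    rw [dist_eq_norm, dist_eq_norm]
    refine (H.norm_h_sub_le hθ hx hy (projZ_mem H.nondeg _) (projZ_mem H.nondeg _)).trans ?_
    exact mul_le_mul_of_nonneg_left (norm_projZ_sub_le _ _) H.eta_nonneg
  refine ⟨G.projZ (hc.fixedPoint _), projZ_mem H.nondeg _, ?_⟩
  have h1 : G.h A.γ x y (G.projZ (hc.fixedPoint _)) θ = hc.fixedPoint _ :=
    hc.fixedPoint_isFixedPt
  have h2 : hc.fixedPoint _ ∈ G.Ωz := by rw [← h1]; exact H.h_mem _
  rw [h1]
  ext j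
  exact (clamp_eq_self (h2 j)).symm

theorem eq_of_fixedPoint (hθ : θ ∈ G.Θ) (hx : x ∈ G.Ωx) (hy : y ∈ G.Ωy) {z w : E N}
    (hz : z ∈ G.Ωz) (hw : w ∈ G.Ωz) (hz' : G.h A.γ x y z θ = z) (hw' : G.h A.γ x y w θ = w) :
    z = w := by
  have h1 := H.norm_h_sub_le hθ hx hy hz hw
  rw [hz', hw'] at h1
  have h2 := H.eta_lt_one
  rw [← sub_eq_zero, ← norm_eq_zero]
  nlinarith [norm_nonneg (z - w)]

/-- Nash equilibria are the fixed points of the projected pseudogradient step. -/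
theorem mem_BRZ_iff (hθ : θ ∈ G.Θ) (hx : x ∈ G.Ωx) (hy : y ∈ G.Ωy) {z : E N} :
    z ∈ G.BRZ x y θ ↔ z ∈ G.Ωz ∧ G.h A.γ x y z θ = z := by
  refine and_congr_right fun hz => ?_
  have key : ∀ i, (∀ t ∈ Icc (G.zmin i) (G.zmax i),
      G.UZ i x y (setCoord z i t) θ ≤ G.UZ i x y z θ) ↔ z i = G.h A.γ x y z θ i := by
    intro i
    have hd : DifferentiableWithinAt ℝ (fun t => G.UZ i x y (setCoord z i t) θ)
        (Icc (G.zmin i) (G.zmax i)) (z i) := by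
      have h1 : ContDiffOn ℝ 1 (fun t => (x, y, setCoord z i t)) (Icc (G.zmin i) (G.zmax i)) :=
        (contDiff_const.prodMk (contDiff_const.prodMk (contDiff_setCoord z i))).contDiffOn
      have h2 := (H.util.smooth_Z θ hθ i).comp h1 fun t ht => ⟨hx, hy, setCoord_mem hz ht⟩
      exact h2.differentiableOn one_ne_zero _ (hz i)
    have h1 := isMaxOn_Icc_iff_eq_clamp H.input.gamma_pos
      (H.util.concave_Z θ hθ i x hx y hy z hz) (hz i) hd.hasDerivWithinAt
    rw [setCoord_self] at h1
    rw [h1]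
    have h2 : z i + A.γ * derivWithin (fun t => G.UZ i x y (setCoord z i t) θ)
        (Icc (G.zmin i) (G.zmax i)) (z i) = G.ω A.γ x y z θ i := by
      simp only [ω, F, UZ, PiLp.sub_apply, PiLp.smul_apply, smul_eq_mul]
      ring
    rw [h2]
    rfl
  constructor
  · intro h
    ext i
    exact ((key i).1 (h i)).symm
  · intro h i
    exact (key i).2 (by rw [h])

theorem brZ_mem_BRZ (hθ : θ ∈ G.Θ) (hx : x ∈ G.Ωx) (hy : y ∈ G.Ωy) :
    G.brZ x y θ ∈ G.BRZ x y θ := by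
  obtain ⟨z, hz, hz'⟩ := H.exists_fixedPoint hθ hx hy
  exact Classical.epsilon_spec (p := fun z => z ∈ G.BRZ x y θ)
    ⟨z, (H.mem_BRZ_iff hθ hx hy).2 ⟨hz, hz'⟩⟩

theorem brZ_mem (hθ : θ ∈ G.Θ) (hx : x ∈ G.Ωx) (hy : y ∈ G.Ωy) : G.brZ x y θ ∈ G.Ωz :=
  (H.brZ_mem_BRZ hθ hx hy).1

theorem h_brZ (hθ : θ ∈ G.Θ) (hx : x ∈ G.Ωx) (hy : y ∈ G.Ωy) :
    G.h A.γ x y (G.brZ x y θ) θ = G.brZ x y θ :=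
  ((H.mem_BRZ_iff hθ hx hy).1 (H.brZ_mem_BRZ hθ hx hy)).2

theorem eq_brZ_of_mem (hθ : θ ∈ G.Θ) (hx : x ∈ G.Ωx) (hy : y ∈ G.Ωy) {z : E N}
    (hz : z ∈ G.BRZ x y θ) : z = G.brZ x y θ :=
  have h1 := (H.mem_BRZ_iff hθ hx hy).1 hz
  H.eq_of_fixedPoint hθ hx hy h1.1 (H.brZ_mem hθ hx hy) h1.2 (H.h_brZ hθ hx hy)

theorem exists_lipschitz_F (hθ : θ ∈ G.Θ) : ∃ L, 0 ≤ L ∧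
    ∀ p ∈ G.Ω, ∀ q ∈ G.Ω, ‖G.F p.1 p.2.1 p.2.2 θ - G.F q.1 q.2.1 q.2.2 θ‖ ≤ L * ‖p - q‖ := by
  obtain ⟨L, hL, -, h⟩ := exists_lipschitz_of_contDiffOn (H.mono.smooth θ hθ) G.convex_Ω
    G.isCompact_Ω (uniqueDiffOn_Ω H.nondeg)
  exact ⟨L, hL, h⟩

theorem exists_lipschitz_brZ (hθ : θ ∈ G.Θ) : ∃ L, 0 ≤ L ∧
    ∀ x ∈ G.Ωx, ∀ y ∈ G.Ωy, ∀ x' ∈ G.Ωx, ∀ y' ∈ G.Ωy,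
      ‖G.brZ x y θ - G.brZ x' y' θ‖ ≤ L * ‖(x, y) - (x', y')‖ := by
  obtain ⟨L, hL, hF⟩ := H.exists_lipschitz_F hθ
  have hη : 0 < 1 - A.η := sub_pos.2 H.eta_lt_one
  have hγ := H.input.gamma_pos
  refine ⟨A.γ * L / (1 - A.η), by positivity, fun x hx y hy x' hx' y' hy' => ?_⟩
  have hz := H.brZ_mem hθ hx hy
  have hz' := H.brZ_mem hθ hx' hy'
  have h1 := H.norm_h_sub_le hθ hx hy hz hz'
  have h2 : ‖G.h A.γ x y (G.brZ x' y' θ) θ - G.h A.γ x' y' (G.brZ x' y' θ) θ‖ ≤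
      A.γ * (L * ‖(x, y) - (x', y')‖) := by
    refine (norm_projZ_sub_le _ _).trans ?_
    have h3 : G.ω A.γ x y (G.brZ x' y' θ) θ - G.ω A.γ x' y' (G.brZ x' y' θ) θ =
        -(A.γ • (G.F x y (G.brZ x' y' θ) θ - G.F x' y' (G.brZ x' y' θ) θ)) := by
      simp only [ω, smul_sub]; abel
    rw [h3, norm_neg, norm_smul, Real.norm_of_nonneg hγ.le]
    have h4 := hF (x, y, G.brZ x' y' θ) ⟨hx, hy, hz'⟩ (x', y', G.brZ x' y' θ) ⟨hx', hy', hz'⟩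
    have h5 : ‖((x, y, G.brZ x' y' θ) : ℝ × ℝ × E N) - (x', y', G.brZ x' y' θ)‖ =
        ‖(x, y) - (x', y')‖ := by
      simp [Prod.norm_def]
    rw [h5] at h4
    gcongr
  rw [H.h_brZ hθ hx' hy'] at h2
  rw [H.h_brZ hθ hx hy] at h1
  rw [div_mul_eq_mul_div, le_div_iff₀ hη]
  have h6 := norm_sub_le_norm_sub_add_norm_sub (G.brZ x y θ) (G.h A.γ x y (G.brZ x' y' θ) θ)
    (G.brZ x' y' θ)
  nlinarith

theorem continuousOn_brZ (hθ : θ ∈ G.Θ) :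
    ContinuousOn (fun p : ℝ × ℝ => G.brZ p.1 p.2 θ) (G.Ωx ×ˢ G.Ωy) := by
  obtain ⟨L, hL, h⟩ := H.exists_lipschitz_brZ hθ
  refine (LipschitzOnWith.of_dist_le_mul (K := ⟨L, hL⟩) fun p hp q hq => ?_).continuousOn
  rw [dist_eq_norm, dist_eq_norm]
  exact h _ hp.1 _ hp.2 _ hq.1 _ hq.2

theorem continuousOn_UX_brZ (hθ : θ ∈ G.Θ) :
    ContinuousOn (fun p : ℝ × ℝ => G.UX p.1 p.2 (G.brZ p.1 p.2 θ)) (G.Ωx ×ˢ G.Ωy) :=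
  H.util.smooth_X.continuousOn.comp
    (continuousOn_fst.prodMk (continuousOn_snd.prodMk (H.continuousOn_brZ hθ)))
    fun _ hp => ⟨hp.1, hp.2, H.brZ_mem hθ hp.1 hp.2⟩

/-! ### Partial Jacobians of the pseudogradient -/

theorem hasFDerivWithinAt_F (hθ : θ ∈ G.Θ) (hx : x ∈ G.Ωx) (hy : y ∈ G.Ωy) {z : E N}
    (hz : z ∈ G.Ωz) : ∃ T : ℝ × E N →L[ℝ] E N,
      HasFDerivWithinAt (fun p : ℝ × E N => G.F p.1 y p.2 θ) T (G.Ωx ×ˢ G.Ωz) (x, z) ∧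
      ∀ r v, T (r, v) = r • G.J₁F x y z θ + G.J₃F x y z θ v := by
  have h1 : ContDiffOn ℝ 1 (fun p : ℝ × E N => G.F p.1 y p.2 θ) (G.Ωx ×ˢ G.Ωz) :=
    (H.mono.smooth θ hθ).comp
      (contDiff_fst.prodMk (contDiff_const.prodMk contDiff_snd)).contDiffOn
      fun _ hp => ⟨hp.1, hy, hp.2⟩
  have hT := (h1.differentiableOn one_ne_zero (x, z) ⟨hx, hz⟩).hasFDerivWithinAt
  refine ⟨_, hT, fun r v => ?_⟩
  have h2 := (hasDerivWithinAt_partial_fst hz hT).derivWithin (uniqueDiffOn_Ωx H.nondeg x hx)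
  have h3 := (hasFDerivWithinAt_partial_snd hx hT).fderivWithin (uniqueDiffOn_Ωz H.nondeg z hz)
  have h4 : ((r, v) : ℝ × E N) = r • ((1 : ℝ), (0 : E N)) + (0, v) := by simp
  rw [h4, map_add, map_smul]
  simp only [J₁F, J₃F]
  rw [h2, h3]
  rfl

theorem hasFDerivWithinAt_F_snd (hθ : θ ∈ G.Θ) (hx : x ∈ G.Ωx) (hy : y ∈ G.Ωy) {z : E N}
    (hz : z ∈ G.Ωz) : HasFDerivWithinAt (fun w => G.F x y w θ) (G.J₃F x y z θ) G.Ωz z := by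
  obtain ⟨T, hT, -⟩ := H.hasFDerivWithinAt_F hθ hx hy hz
  exact (hasFDerivWithinAt_partial_snd hx hT).differentiableWithinAt.hasFDerivWithinAt

theorem norm_sub_J₃F_le (hθ : θ ∈ G.Θ) (hx : x ∈ G.Ωx) (hy : y ∈ G.Ωy) {z : E N}
    (hz : z ∈ G.Ωz) (s : E N) : ‖s - A.γ • G.J₃F x y z θ s‖ ≤ A.η * ‖s‖ := by
  have hω : HasFDerivWithinAt (fun w => G.ω A.γ x y w θ)
      (ContinuousLinearMap.id ℝ (E N) - A.γ • G.J₃F x y z θ) G.Ωz z :=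
    (hasFDerivWithinAt_id z G.Ωz).sub ((H.hasFDerivWithinAt_F_snd hθ hx hy hz).const_smul A.γ)
  -- a small multiple of `s` is the difference of two directions pointing from `z` into the box
  let q : E N := WithLp.toLp 2 fun i => (G.zmin i + G.zmax i) / 2
  obtain ⟨ε, hε, hq⟩ : ∃ ε : ℝ, 0 < ε ∧ q + ε • s ∈ G.Ωz := by
    have h1 : ∀ᶠ ε in 𝓝 (0 : ℝ), ∀ i, q i + ε * s i ∈ Ioo (G.zmin i) (G.zmax i) := by
      rw [eventually_all]
      intro i
      have hc : ContinuousAt (fun ε : ℝ => q i + ε * s i) 0 := by fun_prop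
      refine hc.eventually (isOpen_Ioo.mem_nhds ?_)
      have := H.nondeg.2.2.2.2 i
      simp only [zero_mul, add_zero, q]
      constructor <;> linarith
    obtain ⟨ε, h2, h3⟩ := ((h1.filter_mono nhdsWithin_le_nhds).and
      (self_mem_nhdsWithin : Ioi (0 : ℝ) ∈ 𝓝[>] 0)).exists
    exact ⟨ε, h3, fun i => Ioo_subset_Icc_self (h2 i)⟩
  have hq0 : q ∈ G.Ωz := fun i => by
    have := H.nondeg.2.2.2.2 i
    constructor
    · show G.zmin i ≤ (G.zmin i + G.zmax i) / 2
      linarith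
    · show (G.zmin i + G.zmax i) / 2 ≤ G.zmax i
      linarith
  have key := norm_map_sub_le_of_hasFDerivWithinAt (u := q + ε • s - z) (v := q - z) (η := A.η)
    G.convex_Ωz hω hz (by simpa using hq) (by simpa using hq0)
    fun p hp q hq => H.norm_ω_sub_le hθ hx hy hp hq
  have h1 : q + ε • s - z - (q - z) = ε • s := by abel
  rw [h1, map_smul, norm_smul, norm_smul, mul_left_comm] at key
  exact le_of_mul_le_mul_left key (norm_pos_iff.2 hε.ne')

theorem exists_bound_J₁F (hθ : θ ∈ G.Θ) : ∃ L, 0 ≤ L ∧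
    ∀ x ∈ G.Ωx, ∀ y ∈ G.Ωy, ∀ z ∈ G.Ωz, ‖G.J₁F x y z θ‖ ≤ L := by
  obtain ⟨L, hL, hb, -⟩ := exists_lipschitz_of_contDiffOn (H.mono.smooth θ hθ) G.convex_Ω
    G.isCompact_Ω (uniqueDiffOn_Ω H.nondeg)
  refine ⟨L, hL, fun x hx y hy z hz => ?_⟩
  have hT := ((H.mono.smooth θ hθ).differentiableOn one_ne_zero (x, y, z)
    ⟨hx, hy, hz⟩).hasFDerivWithinAt
  have h1 := (hasDerivWithinAt_partial_fst (t := G.Ωy ×ˢ G.Ωz) ⟨hy, hz⟩ hT).derivWithin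
    (uniqueDiffOn_Ωx H.nondeg x hx)
  simp only [J₁F]
  rw [h1]
  refine (ContinuousLinearMap.le_opNorm _ _).trans ?_
  have h2 : ‖((1 : ℝ), (0 : ℝ × E N))‖ = 1 := by simp [Prod.norm_def]
  rw [h2, mul_one]
  exact hb _ ⟨hx, hy, hz⟩

end Hypotheses

end Game

namespace Game

variable {N m : ℕ} {G : Game N m}

/-! ### Interiors of the regions of the projection -/

variable (G) in
/-- Both points lie in the interior of one and the same region of the projection onto `Ωz`. -/
def SameInterior (v w : E N) : Prop :=
  ∀ j, (v j < G.zmin j ∧ w j < G.zmin j) ∨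
    (v j ∈ Ioo (G.zmin j) (G.zmax j) ∧ w j ∈ Ioo (G.zmin j) (G.zmax j)) ∨
    (G.zmax j < v j ∧ G.zmax j < w j)

theorem SameInterior.projJacobian_eq {D : E N → Fin N → ℝ} (hD : G.IsProjJacobian D) {v w : E N}
    (h : G.SameInterior v w) : D v = D w := by
  funext j
  rcases h j with h | h | h
  · rw [(hD v j).2.2 (.inl h.1), (hD w j).2.2 (.inl h.2)]
  · rw [(hD v j).2.1 h.1, (hD w j).2.1 h.2]
  · rw [(hD v j).2.2 (.inr h.1), (hD w j).2.2 (.inr h.2)]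

theorem SameInterior.projZ_sub {D : E N → Fin N → ℝ} (hN : G.Nondegenerate)
    (hD : G.IsProjJacobian D) {v w : E N} (h : G.SameInterior v w) :
    G.projZ v - G.projZ w = diagMul (D w) (v - w) := by
  ext j
  change max (G.zmin j) (min (G.zmax j) (v j)) - max (G.zmin j) (min (G.zmax j) (w j)) =
    D w j * (v j - w j)
  have hj := hN.2.2.2.2 j
  rcases h j with ⟨h1, h2⟩ | ⟨h1, h2⟩ | ⟨h1, h2⟩
  · rw [(hD w j).2.2 (.inl h2), max_eq_left ((min_le_right _ _).trans h1.le),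
      max_eq_left ((min_le_right _ _).trans h2.le)]
    ring
  · rw [(hD w j).2.1 h2, clamp_eq_self (Ioo_subset_Icc_self h1),
      clamp_eq_self (Ioo_subset_Icc_self h2)]
    ring
  · rw [(hD w j).2.2 (.inr h2), min_eq_left h1.le, min_eq_left h2.le]
    ring

/-- A point within the tolerance of `ω` lies in the interior of the active region of `ω`, if that
region is unique and the tolerance is less than the active radius. -/
theorem sameInterior_of_lt_activeRadius {γ σ x : ℝ} {θ : E m} {c : ℝ × ℝ}
    (huniq : ∃! i, i ∈ G.activeRegions γ θ c x) (hσ0 : 0 ≤ σ) (hσ : σ < G.activeRadius γ θ c x)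
    {w : E N} (hw : ‖w - G.ω γ x (G.φ₁ θ c) (G.φ₂ θ c x) θ‖ ≤ σ) :
    G.SameInterior w (G.ω γ x (G.φ₁ θ c) (G.φ₂ θ c x) θ) := by
  obtain ⟨i, hi, hi'⟩ := huniq
  unfold activeRadius at hσ
  obtain ⟨r, ⟨hr0, hr⟩, hσr⟩ := exists_lt_of_lt_csSup
    (by
      refine ⟨0, le_rfl, ?_⟩
      rw [Metric.closedBall_zero, singleton_subset_iff]
      exact mem_biUnion hi hi) hσ
  set u := G.ω γ x (G.φ₁ θ c) (G.φ₂ θ c x) θ with hu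
  have hball : ∀ v, ‖v - u‖ ≤ r → v ∈ G.region i := by
    intro v hv
    obtain ⟨i', hi'1, hi'2⟩ := mem_iUnion₂.1 (hr (mem_closedBall_iff_norm.2 hv))
    rwa [hi' i' hi'1] at hi'2
  intro j
  have hwj : |w j - u j| ≤ σ := by
    have := PiLp.norm_apply_le (w - u) j
    exact this.trans hw
  have hp := hball (u + EuclideanSpace.single j r) (by
    rw [add_sub_cancel_left, PiLp.norm_single, Real.norm_of_nonneg hr0]) j
  have hm := hball (u + EuclideanSpace.single j (-r)) (by
    rw [add_sub_cancel_left, PiLp.norm_single, norm_neg, Real.norm_of_nonneg hr0]) j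
  simp only [PiLp.add_apply, PiLp.single_apply, if_true] at hp hm
  rw [abs_le] at hwj
  rcases hs : i j with _ | _ | _
  · have h1 := hp.2.1 hs
    have h2 := hm.2.1 hs
    exact .inr (.inl ⟨⟨by linarith [h2.1], by linarith [h1.2]⟩,
      ⟨by linarith [h2.1], by linarith [h1.2]⟩⟩)
  · have h1 := hp.1 hs
    exact .inl ⟨by linarith, by linarith⟩
  · have h1 := hm.2.2 hs
    exact .inr (.inr ⟨by linarith, by linarith⟩)

/-! ### The sensitivity of the bottom-level equilibrium -/

variable (G) in
/-- `s` is the sensitivity of the bottom-level equilibrium: the fixed point of the linearization in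
`x` of the fixed-point equation `z = h(x, y, z)`. -/
def IsSensitivity (A : AlgInput N m) (θ : E m) (x y : ℝ) (s : E N) : Prop :=
  s = G.J₁h A.D A.γ x y (G.brZ x y θ) θ + G.J₃h A.D A.γ x y (G.brZ x y θ) θ s

theorem J₃h_sub (D : E N → Fin N → ℝ) (γ x y : ℝ) (z : E N) (θ : E m) (s t : E N) :
    G.J₃h D γ x y z θ (s - t) = G.J₃h D γ x y z θ s - G.J₃h D γ x y z θ t := by
  simp only [J₃h]
  rw [← diagMul_sub, map_sub, smul_sub]
  congr 1
  abel

namespace Hypotheses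

variable {A : AlgInput N m} {μ κ : ℝ} (H : G.Hypotheses A μ κ) {θ : E m} {x y : ℝ}

include H

theorem norm_J₃h_le (hθ : θ ∈ G.Θ) (hx : x ∈ G.Ωx) (hy : y ∈ G.Ωy) {z : E N}
    (hz : z ∈ G.Ωz) (s : E N) : ‖G.J₃h A.D A.γ x y z θ s‖ ≤ A.η * ‖s‖ :=
  (norm_diagMul_le (fun j => (H.input.projJacobian _ j).1) _).trans
    (H.norm_sub_J₃F_le hθ hx hy hz s)

theorem exists_bound_J₁h (hθ : θ ∈ G.Θ) : ∃ L, 0 ≤ L ∧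
    ∀ x ∈ G.Ωx, ∀ y ∈ G.Ωy, ∀ z ∈ G.Ωz, ‖G.J₁h A.D A.γ x y z θ‖ ≤ L := by
  obtain ⟨L, hL, h⟩ := H.exists_bound_J₁F hθ
  have hγ := H.input.gamma_pos.le
  refine ⟨A.γ * L, by positivity, fun x hx y hy z hz => ?_⟩
  refine (norm_diagMul_le (fun j => (H.input.projJacobian _ j).1) _).trans ?_
  rw [norm_neg, norm_smul, Real.norm_of_nonneg hγ]
  exact mul_le_mul_of_nonneg_left (h x hx y hy z hz) hγ

theorem exists_isSensitivity (hθ : θ ∈ G.Θ) (hx : x ∈ G.Ωx) (hy : y ∈ G.Ωy) :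
    ∃ s, G.IsSensitivity A θ x y s := by
  have hc : ContractingWith ⟨A.η, H.eta_nonneg⟩ fun s =>
      G.J₁h A.D A.γ x y (G.brZ x y θ) θ + G.J₃h A.D A.γ x y (G.brZ x y θ) θ s := by
    refine ⟨H.eta_lt_one, LipschitzWith.of_dist_le_mul fun s t => ?_⟩
    rw [dist_add_left, dist_eq_norm, dist_eq_norm, ← J₃h_sub]
    exact H.norm_J₃h_le hθ hx hy (H.brZ_mem hθ hx hy) _
  exact ⟨hc.fixedPoint _, hc.fixedPoint_isFixedPt.symm⟩

theorem hasDerivWithinAt_brZ (hθ : θ ∈ G.Θ) (hx : x ∈ G.Ωx) (hy : y ∈ G.Ωy) {s : E N}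
    (hs : G.IsSensitivity A θ x y s) {σ : ℝ} (hσ : 0 < σ)
    (hreg : ∀ w, ‖w - G.ω A.γ x y (G.brZ x y θ) θ‖ ≤ σ →
      G.SameInterior w (G.ω A.γ x y (G.brZ x y θ) θ)) :
    HasDerivWithinAt (fun t => G.brZ t y θ) s G.Ωx x := by
  have hz := H.brZ_mem hθ hx hy
  obtain ⟨T, hT, hT'⟩ := H.hasFDerivWithinAt_F hθ hx hy hz
  obtain ⟨L, hL, hlip⟩ := H.exists_lipschitz_brZ hθ
  have hη : 0 < 1 - A.η := sub_pos.2 H.eta_lt_one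
  have hγ := H.input.gamma_pos
  set f : ℝ → E N := fun t => G.brZ t y θ with hf
  have hlip' : ∀ t ∈ G.Ωx, ‖f t - f x‖ ≤ L * ‖t - x‖ := fun t ht => by
    have := hlip t ht y hy x hx y hy
    simpa [Prod.norm_def] using this
  have hcont : ContinuousWithinAt f G.Ωx x :=
    (H.continuousOn_brZ hθ).comp (continuousOn_id.prodMk continuousOn_const)
      (fun _ ht => ⟨ht, hy⟩) x hx
  have hpair : Tendsto (fun t => (t, f t)) (𝓝[G.Ωx] x) (𝓝[G.Ωx ×ˢ G.Ωz] (x, f x)) := by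
    refine tendsto_nhdsWithin_iff.2 ⟨?_, ?_⟩
    · exact (continuousWithinAt_id.prodMk hcont)
    · filter_upwards [self_mem_nhdsWithin] with t ht
      exact ⟨ht, H.brZ_mem hθ ht hy⟩
  -- the remainder of the first-order expansion of the pseudogradient along the equilibria
  set R : ℝ → E N := fun t =>
    G.F t y (f t) θ - G.F x y (f x) θ - T ((t, f t) - (x, f x)) with hR
  have hRo : R =o[𝓝[G.Ωx] x] fun t => t - x := by
    have h1 : R =o[𝓝[G.Ωx] x] fun t => (t, f t) - (x, f x) :=
      (hasFDerivWithinAt_iff_isLittleO.1 hT).comp_tendsto hpair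
    refine h1.trans_isBigO (Asymptotics.IsBigO.of_bound (max 1 L) ?_)
    filter_upwards [self_mem_nhdsWithin] with t ht
    rw [Prod.mk_sub_mk, Prod.norm_def]
    refine max_le ?_ ?_
    · exact le_mul_of_one_le_left (norm_nonneg _) (le_max_left _ _)
    · exact (hlip' t ht).trans (mul_le_mul_of_nonneg_right (le_max_right _ _) (norm_nonneg _))
  rw [hasDerivWithinAt_iff_isLittleO]
  refine Asymptotics.IsBigO.trans_isLittleO
    (Asymptotics.IsBigO.of_bound (A.γ / (1 - A.η)) ?_) hRo
  have hωcont : Tendsto (fun t => G.ω A.γ t y (f t) θ) (𝓝[G.Ωx] x)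
      (𝓝 (G.ω A.γ x y (f x) θ)) := by
    have h1 : Tendsto (fun t => G.F t y (f t) θ) (𝓝[G.Ωx] x) (𝓝 (G.F x y (f x) θ)) :=
      have h2 : ContinuousWithinAt (fun p : ℝ × E N => G.F p.1 y p.2 θ) (G.Ωx ×ˢ G.Ωz) (x, f x) :=
        hT.continuousWithinAt
      h2.tendsto.comp hpair
    exact hcont.tendsto.sub (h1.const_smul A.γ)
  have hnear : ∀ᶠ t in 𝓝[G.Ωx] x,
      ‖G.ω A.γ t y (f t) θ - G.ω A.γ x y (f x) θ‖ < σ := by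
    have := (Metric.tendsto_nhds.1 hωcont) σ hσ
    simpa only [dist_eq_norm] using this
  filter_upwards [hnear, self_mem_nhdsWithin] with t ht htx
  have hproj := (hreg _ ht.le).projZ_sub H.nondeg H.input.projJacobian
  set d := A.D (G.ω A.γ x y (f x) θ) with hd
  have h1 : G.projZ (G.ω A.γ t y (f t) θ) = f t := H.h_brZ hθ htx hy
  have h2 : G.projZ (G.ω A.γ x y (f x) θ) = f x := H.h_brZ hθ hx hy
  rw [h1, h2] at hproj
  have hF : G.F t y (f t) θ - G.F x y (f x) θ =
      (t - x) • G.J₁F x y (f x) θ + G.J₃F x y (f x) θ (f t - f x) + R t := by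
    have := hT' (t - x) (f t - f x)
    rw [← this]
    simp only [hR, Prod.mk_sub_mk]
    abel
  have hωd : G.ω A.γ t y (f t) θ - G.ω A.γ x y (f x) θ =
      (f t - f x) - A.γ • (G.F t y (f t) θ - G.F x y (f x) θ) := by
    simp only [ω, smul_sub]; abel
  set v := f t - f x - (t - x) • s with hv
  have hs' : s = diagMul d (-(A.γ • G.J₁F x y (f x) θ)) +
      diagMul d (s - A.γ • G.J₃F x y (f x) θ s) := hs
  have hvfix : v = diagMul d ((v - A.γ • G.J₃F x y (f x) θ v) - A.γ • R t) := by
    have h3 : v = diagMul d ((f t - f x) - A.γ • (G.F t y (f t) θ - G.F x y (f x) θ)) -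
        (t - x) • (diagMul d (-(A.γ • G.J₁F x y (f x) θ)) +
          diagMul d (s - A.γ • G.J₃F x y (f x) θ s)) := by
      rw [← hs', ← hωd, ← hproj]
    refine h3.trans ?_
    rw [← diagMul_add, ← diagMul_smul, ← diagMul_sub, hF]
    congr 1
    have h5 : G.J₃F x y (f x) θ v =
        G.J₃F x y (f x) θ (f t - f x) - (t - x) • G.J₃F x y (f x) θ s := by
      rw [hv, map_sub, map_smul]
    rw [h5, hv]
    module
  have h4 : ‖v‖ ≤ A.η * ‖v‖ + A.γ * ‖R t‖ := by
    calc ‖v‖ = ‖diagMul d ((v - A.γ • G.J₃F x y (f x) θ v) - A.γ • R t)‖ := by rw [← hvfix]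
      _ ≤ ‖(v - A.γ • G.J₃F x y (f x) θ v) - A.γ • R t‖ :=
          norm_diagMul_le (fun j => (H.input.projJacobian _ j).1) _
      _ ≤ ‖v - A.γ • G.J₃F x y (f x) θ v‖ + ‖A.γ • R t‖ := norm_sub_le _ _
      _ ≤ _ := by
          rw [norm_smul, Real.norm_of_nonneg hγ.le]
          gcongr
          exact H.norm_sub_J₃F_le hθ hx hy hz v
  rw [div_mul_eq_mul_div, le_div_iff₀ hη]
  linarith

/-! ### The inner loop -/

theorem hIter_mem {z : E N} (hz : z ∈ G.Ωz) (n : ℕ) : G.hIter A θ x y z n ∈ G.Ωz := by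
  cases n with
  | zero => exact hz
  | succ n =>
    rw [hIter, Function.iterate_succ_apply']
    exact H.h_mem _

omit H in
theorem hIter_succ (z : E N) (n : ℕ) :
    G.hIter A θ x y z (n + 1) = G.h A.γ x y (G.hIter A θ x y z n) θ :=
  Function.iterate_succ_apply' _ _ _

theorem norm_hIter_sub_brZ_le (hθ : θ ∈ G.Θ) (hx : x ∈ G.Ωx) (hy : y ∈ G.Ωy) {z : E N}
    (hz : z ∈ G.Ωz) (n : ℕ) :
    ‖G.hIter A θ x y z n - G.brZ x y θ‖ ≤ A.η ^ n * ‖z - G.brZ x y θ‖ := by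
  induction n with
  | zero => simp [hIter]
  | succ n ih =>
    have h1 := H.norm_h_sub_le hθ hx hy (H.hIter_mem (θ := θ) (x := x) (y := y) hz n)
      (H.brZ_mem hθ hx hy)
    rw [H.h_brZ hθ hx hy] at h1
    rw [hIter_succ, pow_succ']
    exact h1.trans (by rw [mul_assoc]; exact mul_le_mul_of_nonneg_left ih H.eta_nonneg)

theorem norm_hIter_succ_sub_le (hθ : θ ∈ G.Θ) (hx : x ∈ G.Ωx) (hy : y ∈ G.Ωy) {z : E N}
    (hz : z ∈ G.Ωz) (n : ℕ) :
    ‖G.hIter A θ x y z (n + 1) - G.hIter A θ x y z n‖ ≤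
      A.η ^ n * ‖G.h A.γ x y z θ - z‖ := by
  induction n with
  | zero => simp [hIter]
  | succ n ih =>
    have h1 := H.norm_h_sub_le hθ hx hy (H.hIter_mem (θ := θ) (x := x) (y := y) hz (n + 1))
      (H.hIter_mem (θ := θ) (x := x) (y := y) hz n)
    rw [← hIter_succ, ← hIter_succ] at h1
    rw [pow_succ', mul_assoc]
    exact h1.trans (mul_le_mul_of_nonneg_left ih H.eta_nonneg)

theorem exists_stop₁ (hθ : θ ∈ G.Θ) (hx : x ∈ G.Ωx) (hy : y ∈ G.Ωy) {z : E N}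
    (hz : z ∈ G.Ωz) {σ : ℝ} (hσ : 0 < σ) : ∃ n, G.Stop₁ A θ x y z σ n := by
  have h1 : Tendsto (fun n : ℕ => A.η ^ n * ‖G.h A.γ x y z θ - z‖) atTop (𝓝 (0 * _)) :=
    (tendsto_pow_atTop_nhds_zero_of_lt_one H.eta_nonneg H.eta_lt_one).mul_const _
  rw [zero_mul] at h1
  obtain ⟨n, hn⟩ := (h1.eventually (gt_mem_nhds hσ)).exists
  refine ⟨n + 1, Nat.le_add_left _ _, ?_⟩
  exact (H.norm_hIter_succ_sub_le hθ hx hy hz n).trans hn.le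

theorem exists_stop₂ (hθ : θ ∈ G.Θ) (hx : x ∈ G.Ωx) (hy : y ∈ G.Ωy) {z : E N}
    (hz : z ∈ G.Ωz) {σ : ℝ} (hσ : 0 < σ) : ∃ l, G.Stop₂ A θ x y z σ l := by
  have h0 := tendsto_pow_atTop_nhds_zero_of_lt_one H.eta_nonneg H.eta_lt_one
  have h1 : Tendsto (fun l : ℕ => ((l : ℝ) * A.η ^ l + A.η ^ l) * ‖G.h A.γ x y z θ - z‖) atTop
      (𝓝 ((0 + 0) * _)) :=
    ((tendsto_self_mul_const_pow_of_lt_one H.eta_nonneg H.eta_lt_one).add h0).mul_const _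
  rw [add_zero, zero_mul] at h1
  obtain ⟨l, ⟨hl1, hl2⟩, hl3⟩ := (((h0.eventually (gt_mem_nhds hσ)).and
    (h1.eventually (gt_mem_nhds hσ))).and (eventually_ge_atTop 1)).exists
  refine ⟨l, hl3, max_le hl1.le (le_trans ?_ hl2.le)⟩
  calc _ ≤ ∑ j ∈ Finset.range (l + 1), A.η ^ l * ‖G.h A.γ x y z θ - z‖ := by
        refine Finset.sum_le_sum fun j hj => ?_
        have hjl : j ≤ l := Nat.lt_succ_iff.1 (Finset.mem_range.1 hj)
        calc _ ≤ A.η ^ (l - j) * (A.η ^ j * ‖G.h A.γ x y z θ - z‖) :=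
              mul_le_mul_of_nonneg_left (H.norm_hIter_succ_sub_le hθ hx hy hz j)
                (pow_nonneg H.eta_nonneg _)
          _ = _ := by rw [← mul_assoc, ← pow_add, Nat.sub_add_cancel hjl]
    _ = _ := by
        rw [Finset.sum_const, Finset.card_range, nsmul_eq_mul]
        push_cast
        ring

theorem phase₁_mem {z : E N} (hz : z ∈ G.Ωz) {σ : ℝ} : G.phase₁ A θ x y z σ ∈ G.Ωz :=
  H.hIter_mem hz _

theorem innerLoopTerminates (hθ : θ ∈ G.Θ) (hx : x ∈ G.Ωx) (hy : y ∈ G.Ωy) {z : E N}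
    (hz : z ∈ G.Ωz) {σ : ℝ} (hσ : 0 < σ) : G.InnerLoopTerminates A θ x y z σ :=
  ⟨H.exists_stop₁ hθ hx hy hz hσ, H.exists_stop₂ hθ hx hy (H.phase₁_mem hz) hσ⟩

theorem norm_phase₁_sub_brZ_le (hθ : θ ∈ G.Θ) (hx : x ∈ G.Ωx) (hy : y ∈ G.Ωy) {z : E N}
    (hz : z ∈ G.Ωz) {σ : ℝ} (hσ : 0 < σ) :
    ‖G.phase₁ A θ x y z σ - G.brZ x y θ‖ ≤ A.η / (1 - A.η) * σ := by
  have hη : 0 < 1 - A.η := sub_pos.2 H.eta_lt_one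
  have hleast : G.Stop₁ A θ x y z σ (sInf {n | G.Stop₁ A θ x y z σ n}) :=
    Nat.sInf_mem (H.exists_stop₁ hθ hx hy hz hσ)
  unfold phase₁
  generalize sInf {n | G.Stop₁ A θ x y z σ n} = n at *
  obtain ⟨hn1, hn2⟩ := hleast
  obtain ⟨n, rfl⟩ : ∃ k, n = k + 1 := ⟨n - 1, by omega⟩
  rw [Nat.add_sub_cancel] at hn2
  have h1 := H.norm_h_sub_le hθ hx hy (H.hIter_mem (θ := θ) (x := x) (y := y) hz n)
    (H.brZ_mem hθ hx hy)
  rw [H.h_brZ hθ hx hy, ← hIter_succ] at h1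
  have h2 := norm_sub_le_norm_sub_add_norm_sub (G.hIter A θ x y z n)
    (G.hIter A θ x y z (n + 1)) (G.brZ x y θ)
  rw [norm_sub_rev _ (G.hIter A θ x y z (n + 1))] at h2
  have h3 := mul_le_mul_of_nonneg_left (h2.trans (add_le_add_left hn2 _)) H.eta_nonneg
  rw [div_mul_eq_mul_div, le_div_iff₀ hη]
  linarith

theorem norm_sIter_le (hθ : θ ∈ G.Θ) (hx : x ∈ G.Ωx) (hy : y ∈ G.Ωy) {z s : E N}
    (hz : z ∈ G.Ωz) {L M : ℝ} (hL : ∀ z ∈ G.Ωz, ‖G.J₁h A.D A.γ x y z θ‖ ≤ L)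
    (hLM : L + A.η * M ≤ M) (hs : ‖s‖ ≤ M) (l : ℕ) : ‖G.sIter A θ x y z s l‖ ≤ M := by
  induction l with
  | zero => exact hs
  | succ l ih =>
    have hm := H.hIter_mem (θ := θ) (x := x) (y := y) hz (l + 1)
    refine (norm_add_le _ _).trans (le_trans (add_le_add (hL _ hm)
      ((H.norm_J₃h_le hθ hx hy hm _).trans (mul_le_mul_of_nonneg_left ih H.eta_nonneg))) hLM)

theorem norm_isSensitivity_le (hθ : θ ∈ G.Θ) (hx : x ∈ G.Ωx) (hy : y ∈ G.Ωy) {s : E N}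
    (hs : G.IsSensitivity A θ x y s) {L M : ℝ}
    (hL : ∀ z ∈ G.Ωz, ‖G.J₁h A.D A.γ x y z θ‖ ≤ L) (hLM : L + A.η * M ≤ M) : ‖s‖ ≤ M := by
  have hm := H.brZ_mem hθ hx hy
  have h1 : ‖s‖ ≤ L + A.η * ‖s‖ := by
    conv_lhs => rw [hs]
    exact (norm_add_le _ _).trans (add_le_add (hL _ hm) (H.norm_J₃h_le hθ hx hy hm _))
  have := H.eta_lt_one
  nlinarith

/-- One step of the sensitivity iteration at a profile `w` whose pseudogradient step lies in the
interior of the active region. -/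
theorem norm_sIter_step_le (hθ : θ ∈ G.Θ) (hx : x ∈ G.Ωx) (hy : y ∈ G.Ωy) {s t w : E N}
    (hs : G.IsSensitivity A θ x y s) (hw : w ∈ G.Ωz)
    (hreg : G.SameInterior (G.ω A.γ x y w θ) (G.ω A.γ x y (G.brZ x y θ) θ)) {LF : ℝ}
    (hLF : ∀ z ∈ G.Ωz, ∀ w ∈ G.Ωz, ‖G.J₁F x y z θ - G.J₁F x y w θ‖ ≤ LF * ‖z - w‖ ∧
      ‖G.J₃F x y z θ - G.J₃F x y w θ‖ ≤ LF * ‖z - w‖) :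
    ‖G.J₁h A.D A.γ x y w θ + G.J₃h A.D A.γ x y w θ t - s‖ ≤
      A.η * ‖t - s‖ + A.γ * (LF * ‖w - G.brZ x y θ‖) * (1 + ‖s‖) := by
  have hm := H.brZ_mem hθ hx hy
  have hγ := H.input.gamma_pos.le
  obtain ⟨h1, h3⟩ := hLF w hw _ hm
  set zs := G.brZ x y θ with hzs
  have hD := hreg.projJacobian_eq H.input.projJacobian
  have hs' : s = diagMul (A.D (G.ω A.γ x y w θ)) (-(A.γ • G.J₁F x y zs θ)) +
      diagMul (A.D (G.ω A.γ x y w θ)) (s - A.γ • G.J₃F x y zs θ s) := by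
    rw [hD]; exact hs
  have key : G.J₁h A.D A.γ x y w θ + G.J₃h A.D A.γ x y w θ t - s =
      G.J₃h A.D A.γ x y w θ (t - s) + diagMul (A.D (G.ω A.γ x y w θ))
        (-(A.γ • ((G.J₁F x y w θ - G.J₁F x y zs θ) +
          (G.J₃F x y w θ - G.J₃F x y zs θ) s))) := by
    conv_lhs => rw [hs']
    simp only [J₁h, J₃h]
    rw [← diagMul_add, ← diagMul_add, ← diagMul_add, ← diagMul_sub]
    congr 1
    rw [map_sub, sub_apply]
    module
  rw [key]
  refine (norm_add_le _ _).trans (add_le_add (H.norm_J₃h_le hθ hx hy hw _) ?_)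
  refine (norm_diagMul_le (fun j => (H.input.projJacobian _ j).1) _).trans ?_
  rw [norm_neg, norm_smul, Real.norm_of_nonneg hγ, mul_assoc]
  refine mul_le_mul_of_nonneg_left ?_ hγ
  refine (norm_add_le _ _).trans ?_
  have h4 := (G.J₃F x y w θ - G.J₃F x y zs θ).le_opNorm s
  have h5 := mul_le_mul_of_nonneg_right h3 (norm_nonneg s)
  linarith

/-- The inner loop computes the equilibrium and its sensitivity up to errors of the order of the
tolerance. The tolerance bound need not keep the first profiles of the second phase inside the
active region; all but a fixed number of them are inside, and the effect of the others is damped by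
the requirement `η ^ l ≤ σ` of the stopping test. -/
theorem exists_innerLoop_error_le (hθ : θ ∈ G.Θ) {M : ℝ} (hM : 0 ≤ M) {L : ℝ}
    (hL : ∀ x ∈ G.Ωx, ∀ y ∈ G.Ωy, ∀ z ∈ G.Ωz, ‖G.J₁h A.D A.γ x y z θ‖ ≤ L)
    (hLM : L + A.η * M ≤ M) :
    ∃ C, 0 ≤ C ∧ ∀ x ∈ G.Ωx, ∀ y ∈ G.Ωy, ∀ z ∈ G.Ωz, ∀ s t : E N, ‖s‖ ≤ M → ∀ σ, 0 < σ →
      G.IsSensitivity A θ x y t →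
      (∀ w, ‖w - G.ω A.γ x y (G.brZ x y θ) θ‖ ≤ σ →
        G.SameInterior w (G.ω A.γ x y (G.brZ x y θ) θ)) →
      ‖(G.innerLoop A θ x y z s σ).1 - G.brZ x y θ‖ ≤ C * σ ∧
      ‖(G.innerLoop A θ x y z s σ).2 - t‖ ≤ C * σ := by
  have h0 := H.eta_nonneg
  have h1 := H.eta_lt_one
  have hη : 0 < 1 - A.η := sub_pos.2 h1
  have hγ := H.input.gamma_pos.le
  obtain ⟨LF, hLF⟩ := H.reg.lipschitz_JF
  -- from index `J` on, the profiles of the second phase lie in the interior of the active region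
  obtain ⟨J, hJ0, hJ⟩ : ∃ J : ℕ, (A.η = 0 → J = 0) ∧ A.η ^ J ≤ 1 - A.η := by
    by_cases hz : A.η = 0
    · exact ⟨0, fun _ => rfl, by simp [hz]⟩
    · obtain ⟨J, hJ⟩ := exists_pow_lt_of_lt_one hη h1
      exact ⟨J, fun h => absurd h hz, hJ.le⟩
  set B := A.η / (1 - A.η) with hB
  have hB0 : 0 ≤ B := by positivity
  set C₁ := A.γ * (|LF| * B) * (1 + M) with hC₁
  obtain ⟨K, hK, hK'⟩ := exists_forall_perturbed_le h0 h1 hJ0 (M := M + M) (C := C₁)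
    (by positivity) (by positivity)
  refine ⟨max K B, hK.trans (le_max_left _ _), fun x hx y hy z hz s t hs σ hσ ht hreg => ?_⟩
  have hm := H.brZ_mem hθ hx hy
  have hzt : G.phase₁ A θ x y z σ ∈ G.Ωz := H.phase₁_mem hz
  have hph := H.norm_phase₁_sub_brZ_le hθ hx hy hz hσ
  have hleast : G.Stop₂ A θ x y (G.phase₁ A θ x y z σ) σ
      (sInf {l | G.Stop₂ A θ x y (G.phase₁ A θ x y z σ) σ l}) :=
    Nat.sInf_mem (H.exists_stop₂ hθ hx hy hzt hσ)
  unfold innerLoop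
  dsimp only
  set z' := G.phase₁ A θ x y z σ with hz'
  generalize sInf {l | G.Stop₂ A θ x y z' σ l} = l at *
  have hl2 : A.η ^ l ≤ σ := (le_max_left _ _).trans hleast.2
  have htM : ‖t‖ ≤ M := H.norm_isSensitivity_le hθ hx hy ht (fun z hz => hL x hx y hy z hz) hLM
  have hdist : ∀ n, ‖G.hIter A θ x y z' n - G.brZ x y θ‖ ≤ A.η ^ n * (B * σ) := fun n =>
    (H.norm_hIter_sub_brZ_le hθ hx hy hzt n).trans
      (mul_le_mul_of_nonneg_left hph (pow_nonneg h0 n))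
  constructor
  · refine (hdist l).trans ?_
    have h2 : A.η ^ l ≤ 1 := pow_le_one₀ h0 h1.le
    calc A.η ^ l * (B * σ) ≤ 1 * (B * σ) := by gcongr
      _ ≤ max K B * σ := by rw [one_mul]; gcongr; exact le_max_right _ _
  · refine (hK' (fun l => ‖G.sIter A θ x y z' s l - t‖) σ l hσ.le (fun j => ?_)
      (fun j hj => ?_) hl2).trans (by gcongr; exact le_max_left _ _)
    · refine (norm_sub_le _ _).trans (add_le_add ?_ htM)
      exact H.norm_sIter_le hθ hx hy hzt (fun z hz => hL x hx y hy z hz) hLM hs j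
    · have hw := H.hIter_mem (θ := θ) (x := x) (y := y) hzt (j + 1)
      have hd := hdist (j + 1)
      have hin : ‖G.ω A.γ x y (G.hIter A θ x y z' (j + 1)) θ -
          G.ω A.γ x y (G.brZ x y θ) θ‖ ≤ σ := by
        refine (H.norm_ω_sub_le hθ hx hy hw hm).trans ?_
        -- `η ^ (j + 1)` absorbs the factor `1 / (1 - η)` of the error of the first phase
        have hj' : A.η ^ j ≤ 1 - A.η := (pow_le_pow_of_le_one h0 h1.le hj).trans hJ
        have h3 : A.η ^ (j + 1) * B ≤ 1 := by
          rw [hB, mul_div_assoc', div_le_one hη, pow_succ]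
          have : A.η ^ j * (A.η * A.η) ≤ A.η ^ j * 1 :=
            mul_le_mul_of_nonneg_left (by nlinarith) (pow_nonneg h0 j)
          linarith
        have h4 : A.η ^ (j + 1) * (B * σ) ≤ σ := by
          rw [← mul_assoc]; exact mul_le_of_le_one_left hσ.le h3
        calc _ ≤ 1 * ‖G.hIter A θ x y z' (j + 1) - G.brZ x y θ‖ := by gcongr
          _ ≤ σ := by rw [one_mul]; exact hd.trans h4
      have hstep := H.norm_sIter_step_le hθ hx hy (t := G.sIter A θ x y z' s j) ht hw
        (hreg _ hin) (LF := |LF|) fun z hz w hw => by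
          obtain ⟨ha, hb⟩ := hLF θ hθ x hx y hy z hz w hw
          have := mul_le_mul_of_nonneg_right (le_abs_self LF) (norm_nonneg (z - w))
          exact ⟨ha.trans this, hb.trans this⟩
      refine hstep.trans (add_le_add le_rfl ?_)
      calc _ ≤ A.γ * (|LF| * (A.η ^ (j + 1) * (B * σ))) * (1 + M) := by gcongr
        _ = _ := by rw [hC₁]; ring

end Hypotheses

end Game

namespace Game

variable {N m : ℕ} {G : Game N m}

namespace Hypotheses

variable {A : AlgInput N m} {μ κ : ℝ} (H : G.Hypotheses A μ κ) {θ : E m} {x y : ℝ}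

include H

/-! ### The hypergradient -/

theorem contDiffOn_UX (hy : y ∈ G.Ωy) :
    ContDiffOn ℝ 1 (fun p : ℝ × E N => G.UX p.1 y p.2) (G.Ωx ×ˢ G.Ωz) :=
  H.util.smooth_X.comp (contDiff_fst.prodMk (contDiff_const.prodMk contDiff_snd)).contDiffOn
    fun _ hp => ⟨hp.1, hy, hp.2⟩

theorem hypergradient_eq_fderivWithin (hx : x ∈ G.Ωx) (hy : y ∈ G.Ωy) {z : E N}
    (hz : z ∈ G.Ωz) (s : E N) : G.hypergradient x y z s =
      fderivWithin ℝ (fun p : ℝ × E N => G.UX p.1 y p.2) (G.Ωx ×ˢ G.Ωz) (x, z) (1, s) := by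
  have hT := ((H.contDiffOn_UX hy).differentiableOn one_ne_zero (x, z) ⟨hx, hz⟩).hasFDerivWithinAt
  have h2 := (hasDerivWithinAt_partial_fst hz hT).derivWithin (uniqueDiffOn_Ωx H.nondeg x hx)
  have h3 := (hasFDerivWithinAt_partial_snd hx hT).fderivWithin (uniqueDiffOn_Ωz H.nondeg z hz)
  have h4 : ((1, s) : ℝ × E N) = ((1 : ℝ), (0 : E N)) + (0, s) := by simp
  rw [h4, map_add]
  simp only [hypergradient]
  rw [h2, h3]
  rfl

theorem hasDerivWithinAt_UX_brZ (hθ : θ ∈ G.Θ) (hx : x ∈ G.Ωx) (hy : y ∈ G.Ωy) {s : E N}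
    (hs : HasDerivWithinAt (fun t => G.brZ t y θ) s G.Ωx x) :
    HasDerivWithinAt (fun t => G.UX t y (G.brZ t y θ))
      (G.hypergradient x y (G.brZ x y θ) s) G.Ωx x := by
  have hz := H.brZ_mem hθ hx hy
  have hT := ((H.contDiffOn_UX hy).differentiableOn one_ne_zero (x, G.brZ x y θ)
    ⟨hx, hz⟩).hasFDerivWithinAt
  rw [H.hypergradient_eq_fderivWithin hx hy hz]
  exact HasFDerivWithinAt.comp_hasDerivWithinAt (t := G.Ωx ×ˢ G.Ωz) x hT
    ((hasDerivWithinAt_id x G.Ωx).prodMk hs) fun t ht => ⟨ht, H.brZ_mem hθ ht hy⟩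

theorem exists_bound_hypergradient (hy : y ∈ G.Ωy) : ∃ L, 0 ≤ L ∧ ∀ x ∈ G.Ωx, ∀ z ∈ G.Ωz, ∀ s,
    |G.hypergradient x y z s| ≤ L * (1 + ‖s‖) := by
  obtain ⟨L, hL, hb, -⟩ := exists_lipschitz_of_contDiffOn (H.contDiffOn_UX hy)
    ((convex_Icc _ _).prod G.convex_Ωz) (isCompact_Icc.prod G.isCompact_Ωz)
    ((uniqueDiffOn_Ωx H.nondeg).prod (uniqueDiffOn_Ωz H.nondeg))
  refine ⟨L, hL, fun x hx z hz s => ?_⟩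
  rw [H.hypergradient_eq_fderivWithin hx hy hz, ← Real.norm_eq_abs]
  refine (ContinuousLinearMap.le_opNorm _ _).trans ?_
  have h1 : ‖((1 : ℝ), s)‖ ≤ 1 + ‖s‖ := by
    rw [Prod.norm_def]
    refine max_le ?_ ?_
    · simp
    · simp
  exact mul_le_mul (hb _ ⟨hx, hz⟩) h1 (norm_nonneg _) hL

theorem contDiffOn_f₁ (hy : y ∈ G.Ωy) : ContDiffOn ℝ 1 (G.f₁ y) G.Ωz := by
  have hlt := H.nondeg.2.2.1
  have h1 : ∀ x ∈ G.Ωx, ContDiffOn ℝ 1 (fun z => G.UX x y z) G.Ωz := fun x hx =>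
    (H.contDiffOn_UX hy).comp (contDiff_const.prodMk contDiff_id).contDiffOn
      fun _ hz => ⟨hx, hz⟩
  -- the affine dependence of the utility on `x` recovers `f₁` from two values of `x`
  have h2 := ((h1 _ (right_mem_Icc.2 hlt.le)).sub (h1 _ (left_mem_Icc.2 hlt.le))).sub
    (contDiffOn_const (c := G.B G.xmax G.θ₀ - G.B G.xmin G.θ₀)) |>.div_const (G.xmax - G.xmin)
  refine h2.congr fun z _ => ?_
  have h3 : G.xmax - G.xmin ≠ 0 := (sub_pos.2 hlt).ne'
  simp only [UX]
  field_simp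
  ring

theorem hypergradient_eq (hx : x ∈ G.Ωx) (hy : y ∈ G.Ωy) {z : E N} (hz : z ∈ G.Ωz) (s : E N) :
    G.hypergradient x y z s = derivWithin (fun t => G.B t G.θ₀) G.Ωx x + G.f₁ y z +
      x * fderivWithin ℝ (G.f₁ y) G.Ωz z s := by
  have hu := uniqueDiffOn_Ωx H.nondeg x hx
  have huz := uniqueDiffOn_Ωz H.nondeg z hz
  have hUX : DifferentiableWithinAt ℝ (fun t => G.UX t y z) G.Ωx x :=
    (hasDerivWithinAt_partial_fst hz ((H.contDiffOn_UX hy).differentiableOn one_ne_zero (x, z)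
      ⟨hx, hz⟩).hasFDerivWithinAt).differentiableWithinAt
  have hlin : HasDerivWithinAt (fun t => G.f₁ y z * t) (G.f₁ y z) G.Ωx x := by
    simpa using (hasDerivWithinAt_id x G.Ωx).const_mul (G.f₁ y z)
  have hB : DifferentiableWithinAt ℝ (fun t => G.B t G.θ₀) G.Ωx x := by
    refine (hUX.sub hlin.differentiableWithinAt).congr (fun t _ => ?_) ?_ <;>
    simp [UX]
  have h1 : derivWithin (fun t => G.UX t y z) G.Ωx x =
      derivWithin (fun t => G.B t G.θ₀) G.Ωx x + G.f₁ y z :=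
    (hB.hasDerivWithinAt.add hlin).derivWithin hu
  have hf := ((H.contDiffOn_f₁ hy).differentiableOn one_ne_zero z hz).hasFDerivWithinAt
  have h2 : fderivWithin ℝ (fun w => G.UX x y w) G.Ωz z = x • fderivWithin ℝ (G.f₁ y) G.Ωz z :=
    ((hf.mul_const x).const_add (G.B x G.θ₀)).fderivWithin huz
  rw [hypergradient, h1, h2]
  rfl

theorem exists_lipschitz_hypergradient (hy : y ∈ G.Ωy) {M : ℝ} (hM : 0 ≤ M) : ∃ L, 0 ≤ L ∧
    ∀ x ∈ G.Ωx, ∀ z ∈ G.Ωz, ∀ w ∈ G.Ωz, ∀ s t, ‖s‖ ≤ M →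
      |G.hypergradient x y z s - G.hypergradient x y w t| ≤ L * (‖z - w‖ + ‖s - t‖) := by
  obtain ⟨L₁, hL₁, hb, hlip⟩ := exists_lipschitz_of_contDiffOn (H.contDiffOn_f₁ hy)
    G.convex_Ωz G.isCompact_Ωz (uniqueDiffOn_Ωz H.nondeg)
  obtain ⟨L₂, hL₂⟩ := H.reg.lipschitz_gradf₁
  set X := max |G.xmin| |G.xmax| with hX
  have hX0 : 0 ≤ X := (abs_nonneg _).trans (le_max_left _ _)
  refine ⟨L₁ + X * (L₂ * M) + X * L₁, by positivity, fun x hx z hz w hw s t hs => ?_⟩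
  rw [H.hypergradient_eq hx hy hz, H.hypergradient_eq hx hy hw]
  have h1 := hlip z hz w hw
  have h2 : ‖fderivWithin ℝ (G.f₁ y) G.Ωz z - fderivWithin ℝ (G.f₁ y) G.Ωz w‖ ≤
      L₂ * ‖z - w‖ := by
    have := hL₂.dist_le_mul (y, z) ⟨hy, hz⟩ (y, w) ⟨hy, hw⟩
    rw [dist_eq_norm, dist_eq_norm] at this
    simpa [Prod.norm_def] using this
  have hxX : |x| ≤ X := abs_le_max_abs_abs hx.1 hx.2
  set P := fderivWithin ℝ (G.f₁ y) G.Ωz z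
  set Q := fderivWithin ℝ (G.f₁ y) G.Ωz w with hQ
  have h3 : |P s - Q t| ≤ L₂ * ‖z - w‖ * M + L₁ * ‖s - t‖ := by
    have h4 : P s - Q t = (P - Q) s + Q (s - t) := by
      rw [sub_apply, map_sub]; ring
    rw [h4]
    refine (abs_add_le _ _).trans (add_le_add ?_ ?_)
    · exact ((P - Q).le_opNorm s).trans (by gcongr)
    · exact (Q.le_opNorm _).trans (by gcongr; exact hb w hw)
  calc _ = |(G.f₁ y z - G.f₁ y w) + x * (P s - Q t)| := by congr 1; ring
    _ ≤ |G.f₁ y z - G.f₁ y w| + |x| * |P s - Q t| := by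
        rw [← abs_mul]; exact abs_add_le _ _
    _ ≤ L₁ * ‖z - w‖ + X * (L₂ * ‖z - w‖ * M + L₁ * ‖s - t‖) := by
        gcongr
        exact h1
    _ ≤ _ := by
        have h5 : 0 ≤ L₁ * ‖s - t‖ := by positivity
        have h6 : 0 ≤ X * (L₂ * M) * ‖s - t‖ := by positivity
        have h7 : 0 ≤ X * L₁ * ‖z - w‖ := by positivity
        linarith

/-! ### Convergence of the iterates on an interval -/

omit H in
theorem _root_.Deception.Game.IsCell.Icc_subset {c : ℝ × ℝ} (hc : G.IsCell θ c) :
    Icc c.1 c.2 ⊆ G.Ωx := Icc_subset_Icc hc.2.2.2.1.1 hc.2.2.2.2.1.2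

theorem φ₁_mem (θ : E m) (c : ℝ × ℝ) : G.φ₁ θ c ∈ G.Ωy := by
  have hlt := H.nondeg.2.2.2.1
  unfold φ₁
  split_ifs
  · exact right_mem_Icc.2 hlt.le
  · exact left_mem_Icc.2 hlt.le

theorem continuousOn_UXhat (hθ : θ ∈ G.Θ) (c : ℝ × ℝ) : ContinuousOn (G.UXhat θ c) G.Ωx :=
  (H.continuousOn_UX_brZ hθ).comp (continuousOn_id.prodMk continuousOn_const)
    fun _ ht => ⟨ht, H.φ₁_mem θ c⟩

theorem xIter_mem (hθ : θ ∈ G.Θ) {c : ℝ × ℝ} (hc : G.IsCell θ c) (k : ℕ) :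
    G.xIter A θ c k ∈ Icc c.1 c.2 := by
  cases k with
  | zero => exact H.input.init_x θ hθ c hc
  | succ k => exact clamp_mem hc.1.le _

theorem zIter_mem (hθ : θ ∈ G.Θ) {c : ℝ × ℝ} (hc : G.IsCell θ c) (k : ℕ) :
    (G.iter A θ c k).2.1 ∈ G.Ωz := by
  induction k with
  | zero => exact H.input.init_z θ hθ c hc
  | succ k ih => exact H.hIter_mem (H.phase₁_mem ih) _

theorem norm_sIter_outer_le (hθ : θ ∈ G.Θ) {c : ℝ × ℝ} (hc : G.IsCell θ c) {L M : ℝ}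
    (hL : ∀ x ∈ G.Ωx, ∀ y ∈ G.Ωy, ∀ z ∈ G.Ωz, ‖G.J₁h A.D A.γ x y z θ‖ ≤ L)
    (hLM : L + A.η * M ≤ M) (h0 : ‖A.s₀ θ c‖ ≤ M) (k : ℕ) :
    ‖(G.iter A θ c k).2.2‖ ≤ M := by
  induction k with
  | zero => exact h0
  | succ k ih =>
    have hx := hc.Icc_subset (H.xIter_mem hθ hc k)
    have hy := H.φ₁_mem θ c
    exact H.norm_sIter_le hθ hx hy (H.phase₁_mem (H.zIter_mem hθ hc k))
      (fun z hz => hL _ hx _ hy z hz) hLM ih _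

/-- The iterates on an interval converge to a maximizer of the leader's utility along it: the
computed hypergradient differs from the derivative of that concave utility by the order of the
tolerance, so the iteration is inexact projected gradient ascent. -/
theorem xIter_tendsto (h_tol : G.ToleranceAssumption A) (h_single : G.SingletonAssumption A)
    (hθ : θ ∈ G.Θ) {c : ℝ × ℝ} (hc : G.IsCell θ c) :
    ∃ l ∈ Icc c.1 c.2, Tendsto (G.xIter A θ c) atTop (𝓝 l) ∧
      ∀ t ∈ Icc c.1 c.2, G.UXhat θ c t ≤ G.UXhat θ c l := by
  have hη : 0 < 1 - A.η := sub_pos.2 H.eta_lt_one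
  have hy := H.φ₁_mem θ c
  obtain ⟨L, hL0, hL⟩ := H.exists_bound_J₁h hθ
  set M := max ‖A.s₀ θ c‖ (L / (1 - A.η)) with hM
  have hM0 : 0 ≤ M := (norm_nonneg _).trans (le_max_left _ _)
  have hLM : L + A.η * M ≤ M := by
    have := le_max_right ‖A.s₀ θ c‖ (L / (1 - A.η))
    rw [← hM, div_le_iff₀ hη] at this
    linarith
  have hsM := H.norm_sIter_outer_le hθ hc hL hLM (le_max_left _ _)
  obtain ⟨C, hC0, hC⟩ := H.exists_innerLoop_error_le hθ hM0 hL hLM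
  obtain ⟨L₁, hL₁, hbound⟩ := H.exists_bound_hypergradient hy
  obtain ⟨L₂, hL₂, hlip⟩ := H.exists_lipschitz_hypergradient hy hM0
  refine projectedAscent_tendsto hc.1.le ?_ ?_
    (x := G.xIter A θ c) (α := A.α) (σ := A.σ)
    (g := fun k => G.hypergradient (G.xIter A θ c k) (G.φ₁ θ c)
      (G.iter A θ c (k + 1)).2.1 (G.iter A θ c (k + 1)).2.2)
    (C := L₂ * (C + C)) (M := L₁ * (1 + M)) (by positivity)
    (H.xIter_mem hθ hc) (fun k => rfl) ?_
    H.input.alpha_nonneg (fun k => (H.input.sigma_pos k).le) H.input.alpha_nonsummable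
    H.input.alpha_sq_summable H.input.alpha_sigma_summable
  · exact H.conc θ hθ _ hy c hc
  · exact (H.continuousOn_UXhat hθ c).mono hc.Icc_subset
  · obtain ⟨k₀, hk₀⟩ := h_tol θ hθ c hc
    have h1 : ∀ᶠ k in atTop, ∃! i, i ∈ G.activeRegions A.γ θ c (G.xIter A θ c k) := by
      rw [← Nat.cofinite_eq_atTop]
      exact h_single θ hθ c hc
    filter_upwards [h1, eventually_gt_atTop k₀] with k hk hkk
    have hx := hc.Icc_subset (H.xIter_mem hθ hc k)
    have hσ := H.input.sigma_pos k
    have hz := H.zIter_mem hθ hc k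
    have hreg : ∀ w, ‖w - G.ω A.γ (G.xIter A θ c k) (G.φ₁ θ c)
        (G.brZ (G.xIter A θ c k) (G.φ₁ θ c) θ) θ‖ ≤ A.σ k → G.SameInterior w _ := fun w hw =>
      sameInterior_of_lt_activeRadius hk hσ.le (hk₀ k hkk) hw
    obtain ⟨t, ht⟩ := H.exists_isSensitivity hθ hx hy
    obtain ⟨he1, he2⟩ := hC _ hx _ hy _ hz _ t (hsM k) _ hσ ht hreg
    have hd := H.hasDerivWithinAt_UX_brZ hθ hx hy (H.hasDerivWithinAt_brZ hθ hx hy ht hσ hreg)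
    refine ⟨_, hd.mono hc.Icc_subset, ?_, ?_⟩
    · refine (hlip _ hx _ (H.zIter_mem hθ hc (k + 1)) _ (H.brZ_mem hθ hx hy) _ _
        (hsM (k + 1))).trans ?_
      rw [mul_assoc, add_mul]
      exact mul_le_mul_of_nonneg_left (add_le_add he1 he2) hL₂
    · refine (hbound _ hx _ (H.zIter_mem hθ hc (k + 1)) _).trans ?_
      exact mul_le_mul_of_nonneg_left (by linarith [hsM (k + 1)]) hL₁

/-! ### The middle-level response and the leader's utilities -/

theorem continuousOn_f₂ (hθ : θ ∈ G.Θ) : ContinuousOn (fun x => G.f₂ x θ) G.Ωx := by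
  have hlt := H.nondeg.2.2.2.1
  have h1 : ∀ y ∈ G.Ωy, ContinuousOn (fun x => G.UY x y θ) G.Ωx := fun y hy =>
    (H.util.smooth_Y θ hθ).continuousOn.comp (continuousOn_id.prodMk continuousOn_const)
      fun _ hx => ⟨hx, hy⟩
  refine (((h1 _ (right_mem_Icc.2 hlt.le)).sub (h1 _ (left_mem_Icc.2 hlt.le))).div_const
    (G.ymax - G.ymin)).congr fun x _ => ?_
  have h3 : G.ymax - G.ymin ≠ 0 := (sub_pos.2 hlt).ne'
  simp only [UY, Pi.sub_apply]
  field_simp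
  ring

/-- The response `φ₁` read off from the midpoint of an interval is the sign response at every point
of the closed interval that is no zero of `f₂`. -/
theorem f₂_pos_iff (hθ : θ ∈ G.Θ) {c : ℝ × ℝ} (hc : G.IsCell θ c) (hx : x ∈ Icc c.1 c.2)
    (h0 : G.f₂ x θ ≠ 0) : 0 < G.f₂ ((c.1 + c.2) / 2) θ ↔ 0 < G.f₂ x θ := by
  have hlt := hc.1
  have hmid : (c.1 + c.2) / 2 ∈ Ioo c.1 c.2 := ⟨by linarith, by linarith⟩
  have hsub : uIcc x ((c.1 + c.2) / 2) ⊆ Icc c.1 c.2 :=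
    (convex_Icc c.1 c.2).ordConnected.uIcc_subset hx (Ioo_subset_Icc_self hmid)
  have hne : ∀ t ∈ uIcc x ((c.1 + c.2) / 2), G.f₂ t θ ≠ 0 := by
    intro t ht
    by_cases htx : t = x
    · rwa [htx]
    · refine hc.2.2.2.2.2 t ?_
      rcases le_total x ((c.1 + c.2) / 2) with h | h
      · rw [uIcc_of_le h] at ht
        exact ⟨hx.1.trans_lt (lt_of_le_of_ne ht.1 (Ne.symm htx)), ht.2.trans_lt hmid.2⟩
      · rw [uIcc_of_ge h] at ht
        exact ⟨hmid.1.trans_le ht.1, (lt_of_le_of_ne ht.2 htx).trans_le hx.2⟩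
  have hivt := intermediate_value_uIcc
    ((H.continuousOn_f₂ hθ).mono (hsub.trans hc.Icc_subset))
  have hnot : (0 : ℝ) ∉ uIcc (G.f₂ x θ) (G.f₂ ((c.1 + c.2) / 2) θ) := fun h => by
    obtain ⟨t, ht, ht0⟩ := hivt h
    exact hne t ht ht0
  have hm0 := hne _ right_mem_uIcc
  constructor
  · intro h
    by_contra hcon
    exact hnot (by rw [uIcc_of_le (by linarith)]; exact ⟨by linarith, h.le⟩)
  · intro h
    by_contra hcon
    exact hnot (by rw [uIcc_of_ge (by linarith)]; exact ⟨by linarith, h.le⟩)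

theorem BRY_eq_singleton (hθ : θ ∈ G.Θ) {c : ℝ × ℝ} (hc : G.IsCell θ c)
    (hx : x ∈ Icc c.1 c.2) (h0 : G.f₂ x θ ≠ 0) : G.BRY x θ = {G.φ₁ θ c} := by
  have hlt := H.nondeg.2.2.2.1
  have hsign := H.f₂_pos_iff hθ hc hx h0
  ext y
  simp only [BRY, UY, φ₁, mem_singleton_iff, mem_ofPred_eq]
  split_ifs with hp
  · have hpos := hsign.1 hp
    constructor
    · rintro ⟨hy, hmax⟩
      have := hmax _ (right_mem_Icc.2 hlt.le)
      exact le_antisymm hy.2 (by nlinarith)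
    · rintro rfl
      exact ⟨right_mem_Icc.2 hlt.le, fun y' hy' => by nlinarith [hy'.2]⟩
  · have hneg : G.f₂ x θ < 0 := lt_of_le_of_ne (not_lt.1 fun h => hp (hsign.2 h)) h0
    constructor
    · rintro ⟨hy, hmax⟩
      have := hmax _ (left_mem_Icc.2 hlt.le)
      exact le_antisymm (by nlinarith) hy.1
    · rintro rfl
      exact ⟨left_mem_Icc.2 hlt.le, fun y' hy' => by nlinarith [hy'.1]⟩

omit H in
theorem BRY_eq_Ωy (h0 : G.f₂ x θ = 0) : G.BRY x θ = G.Ωy := by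
  ext y
  simp [BRY, UY, h0]

theorem responseValues_eq_image (hθ : θ ∈ G.Θ) (hx : x ∈ G.Ωx) :
    G.responseValues x θ = (fun y => G.UX x y (G.brZ x y θ)) '' G.BRY x θ := by
  ext u
  constructor
  · rintro ⟨y, hy, z, hz, rfl⟩
    exact ⟨y, hy, by rw [H.eq_brZ_of_mem hθ hx hy.1 hz]⟩
  · rintro ⟨y, hy, rfl⟩
    exact ⟨y, hy, _, H.brZ_mem_BRZ hθ hx hy.1, rfl⟩

theorem responseValues_of_ne (hθ : θ ∈ G.Θ) {c : ℝ × ℝ} (hc : G.IsCell θ c)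
    (hx : x ∈ Icc c.1 c.2) (h0 : G.f₂ x θ ≠ 0) :
    G.responseValues x θ = {G.UXhat θ c x} := by
  rw [H.responseValues_eq_image hθ (hc.Icc_subset hx), H.BRY_eq_singleton hθ hc hx h0,
    image_singleton]
  rfl

theorem worst_of_ne (hθ : θ ∈ G.Θ) {c : ℝ × ℝ} (hc : G.IsCell θ c)
    (hx : x ∈ Icc c.1 c.2) (h0 : G.f₂ x θ ≠ 0) : G.worst x θ = G.UXhat θ c x := by
  rw [worst, H.responseValues_of_ne hθ hc hx h0, csInf_singleton]

theorem best_of_ne (hθ : θ ∈ G.Θ) {c : ℝ × ℝ} (hc : G.IsCell θ c)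
    (hx : x ∈ Icc c.1 c.2) (h0 : G.f₂ x θ ≠ 0) : G.best x θ = G.UXhat θ c x := by
  rw [best, H.responseValues_of_ne hθ hc hx h0, csSup_singleton]

theorem worst_of_zero (hθ : θ ∈ G.Θ) (hx : x ∈ G.zeros θ) :
    G.worst x θ = G.zeroUtility x θ .pessimistic := by
  rw [worst, H.responseValues_eq_image hθ hx.1, BRY_eq_Ωy hx.2]
  rfl

theorem best_of_zero (hθ : θ ∈ G.Θ) (hx : x ∈ G.zeros θ) :
    G.best x θ = G.zeroUtility x θ .optimistic := by
  rw [best, H.responseValues_eq_image hθ hx.1, BRY_eq_Ωy hx.2]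
  rfl

theorem isCompact_responseValues_of_zero (hθ : θ ∈ G.Θ) (hx : x ∈ G.zeros θ) :
    IsCompact (G.responseValues x θ) ∧ (G.responseValues x θ).Nonempty := by
  rw [H.responseValues_eq_image hθ hx.1, BRY_eq_Ωy hx.2]
  refine ⟨isCompact_Icc.image_of_continuousOn ?_, (nonempty_Icc.2 H.nondeg.2.2.2.1.le).image _⟩
  exact (H.continuousOn_UX_brZ hθ).comp (continuousOn_const.prodMk continuousOn_id)
    fun _ hy => ⟨hx.1, hy⟩

omit H in
/-- A cut of `Ωx` into a lower part `D` and its complement determines an interval of the partition: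
from the last division point in `D` to the first one outside. -/
theorem exists_isCell_of_cut (hfin : (G.zeros θ).Finite) (hlt : G.xmin < G.xmax) {D : Set ℝ}
    (hD : ∀ t ∈ D, t ≤ x) (hD' : ∀ t ∉ D, x ≤ t) (hmin : G.xmin ∈ D) (hmax : G.xmax ∉ D) :
    ∃ c, G.IsCell θ c ∧ x ∈ Icc c.1 c.2 := by
  set S : Set ℝ := insert G.xmin (insert G.xmax (G.zeros θ)) with hS
  have hSfin : S.Finite := (hfin.insert _).insert _
  have hSx : ∀ t ∈ S, t ∈ G.Ωx := by
    rintro t (rfl | rfl | ht)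
    · exact left_mem_Icc.2 hlt.le
    · exact right_mem_Icc.2 hlt.le
    · exact ht.1
  have hSz : ∀ t ∈ G.zeros θ, t ∈ S := fun t ht => .inr (.inr ht)
  obtain ⟨a, ⟨haS, haD⟩, ha⟩ := exists_max_image (S ∩ D) id (hSfin.inter_of_left D)
    ⟨G.xmin, .inl rfl, hmin⟩
  obtain ⟨b, ⟨hbS, hbD⟩, hb⟩ := exists_min_image (S ∩ Dᶜ) id (hSfin.inter_of_left Dᶜ)
    ⟨G.xmax, .inr (.inl rfl), hmax⟩
  simp only [id] at ha hb
  have hax := hD a haD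
  have hxb := hD' b hbD
  have hab : a < b := lt_of_le_of_ne (hax.trans hxb) fun h => hbD (h ▸ haD)
  refine ⟨(a, b), ⟨hab, ?_, ?_, hSx a haS, hSx b hbS, fun t ht ht0 => ?_⟩, hax, hxb⟩
  · rcases haS with h | h | h
    · exact .inl h
    · exact absurd (h ▸ haD) hmax
    · exact .inr h
  · rcases hbS with h | h | h
    · exact absurd (h ▸ hmin) hbD
    · exact .inl h
    · exact .inr h
  · have htS : t ∈ S := hSz t ⟨⟨(hSx a haS).1.trans ht.1.le, ht.2.le.trans (hSx b hbS).2⟩, ht0⟩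
    by_cases htD : t ∈ D
    · exact absurd (ha t ⟨htS, htD⟩) (not_le.2 ht.1)
    · exact absurd (hb t ⟨htS, htD⟩) (not_le.2 ht.2)

theorem exists_isCell (hθ : θ ∈ G.Θ) (hx : x ∈ G.Ωx) : ∃ c, G.IsCell θ c ∧ x ∈ Icc c.1 c.2 := by
  have hlt := H.nondeg.2.2.1
  have hfin := H.reg.finite_zeros θ hθ
  rcases hx.2.lt_or_eq with h | h
  · exact exists_isCell_of_cut hfin hlt (D := Iic x) (fun t ht => ht)
      (fun t ht => (not_le.1 ht).le) hx.1 (not_le.2 h)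
  · exact exists_isCell_of_cut hfin hlt (D := Iio x) (fun t ht => le_of_lt ht)
      (fun t ht => not_lt.1 ht) (by rw [h]; exact hlt) (by rw [h]; exact lt_irrefl G.xmax)

/-! ### Candidates and outputs -/

theorem finite_candidates (att : Attitude) :
    {p : ℝ × ℝ × E m | p.2.2 ∈ G.Θ ∧ G.IsCandidate A att p.1 p.2.1 p.2.2}.Finite := by
  have hcells : ∀ θ ∈ G.Θ, {c | G.IsCell θ c}.Finite := fun θ hθ => by
    have hS : (insert G.xmin (insert G.xmax (G.zeros θ))).Finite :=
      ((H.reg.finite_zeros θ hθ).insert _).insert _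
    refine (hS.prod hS).subset fun c hc => ⟨?_, ?_⟩
    · rcases hc.2.1 with h | h
      · exact .inl h
      · exact .inr (.inr h)
    · rcases hc.2.2.1 with h | h
      · exact .inr (.inl h)
      · exact .inr (.inr h)
  have hlim : ∀ θ c, {p : ℝ × ℝ × E m | Tendsto (G.xIter A θ c) atTop (𝓝 p.2.1) ∧
      p.1 = G.UXhat θ c p.2.1 ∧ p.2.2 = θ}.Finite := fun θ c => by
    refine Set.Subsingleton.finite ?_
    rintro ⟨u, x, t⟩ ⟨h1, h2, h3⟩ ⟨u', x', t'⟩ ⟨h1', h2', h3'⟩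
    dsimp only at h1 h2 h3 h1' h2' h3'
    have hx := tendsto_nhds_unique h1 h1'
    subst hx h3 h3'
    rw [h2, h2']
  refine (H.util.finite_Θ.biUnion fun θ hθ =>
    ((hcells θ hθ).biUnion fun c _ => hlim θ c).union
      ((H.reg.finite_zeros θ hθ).image fun x => (G.zeroUtility x θ att, x, θ))).subset ?_
  rintro ⟨u, x, θ⟩ ⟨hθ, hcand⟩
  refine mem_biUnion hθ ?_
  rcases hcand with ⟨c, hc, ht, hu⟩ | ⟨hz, hu⟩
  · exact .inl (mem_biUnion hc ⟨ht, hu, rfl⟩)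
  · exact .inr ⟨x, hz, Prod.ext hu.symm rfl⟩

theorem exists_isOutput (h_tol : G.ToleranceAssumption A) (h_single : G.SingletonAssumption A)
    (att : Attitude) : ∃ u x θ, G.IsOutput A att u x θ := by
  obtain ⟨θ, hθ⟩ := H.nondeg.2.1
  obtain ⟨c, hc, -⟩ := H.exists_isCell hθ (left_mem_Icc.2 H.nondeg.2.2.1.le)
  obtain ⟨l, -, hlim, -⟩ := H.xIter_tendsto h_tol h_single hθ hc
  obtain ⟨⟨u, x, t⟩, ⟨h1, h2⟩, h3⟩ := exists_max_image _ Prod.fst (H.finite_candidates att)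
    ⟨(G.UXhat θ c l, l, θ), hθ, .inl ⟨c, hc, hlim, rfl⟩⟩
  exact ⟨u, x, t, h1, h2, fun u' x' θ' hθ' h' => h3 (u', x', θ') ⟨hθ', h'⟩⟩

theorem exists_candidate_UXhat_le (h_tol : G.ToleranceAssumption A)
    (h_single : G.SingletonAssumption A) (att : Attitude) (hθ : θ ∈ G.Θ) {c : ℝ × ℝ}
    (hc : G.IsCell θ c) (hx : x ∈ Icc c.1 c.2) :
    ∃ u x', G.IsCandidate A att u x' θ ∧ G.UXhat θ c x ≤ u := by
  obtain ⟨l, -, hlim, hmax⟩ := H.xIter_tendsto h_tol h_single hθ hc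
  exact ⟨_, l, .inl ⟨c, hc, hlim, rfl⟩, hmax x hx⟩

theorem best_le_of_isOutput (h_tol : G.ToleranceAssumption A)
    (h_single : G.SingletonAssumption A) {u x' : ℝ} {θ' : E m}
    (hout : G.IsOutput A .optimistic u x' θ') (hθ : θ ∈ G.Θ) (hx : x ∈ G.Ωx) :
    G.best x θ ≤ u := by
  by_cases h0 : G.f₂ x θ = 0
  · rw [H.best_of_zero hθ ⟨hx, h0⟩]
    exact hout.2.2 _ x θ hθ (.inr ⟨⟨hx, h0⟩, rfl⟩)
  · obtain ⟨c, hc, hxc⟩ := H.exists_isCell hθ hx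
    obtain ⟨v, t, hv, hle⟩ := H.exists_candidate_UXhat_le h_tol h_single .optimistic hθ hc hxc
    rw [H.best_of_ne hθ hc hxc h0]
    exact hle.trans (hout.2.2 v t θ hθ hv)

theorem worst_le_of_isOutput (h_tol : G.ToleranceAssumption A)
    (h_single : G.SingletonAssumption A) {u x' : ℝ} {θ' : E m}
    (hout : G.IsOutput A .pessimistic u x' θ') (hθ : θ ∈ G.Θ) (hx : x ∈ G.Ωx) :
    G.worst x θ ≤ u := by
  by_cases h0 : G.f₂ x θ = 0
  · rw [H.worst_of_zero hθ ⟨hx, h0⟩]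
    exact hout.2.2 _ x θ hθ (.inr ⟨⟨hx, h0⟩, rfl⟩)
  · obtain ⟨c, hc, hxc⟩ := H.exists_isCell hθ hx
    obtain ⟨v, t, hv, hle⟩ := H.exists_candidate_UXhat_le h_tol h_single .pessimistic hθ hc hxc
    rw [H.worst_of_ne hθ hc hxc h0]
    exact hle.trans (hout.2.2 v t θ hθ hv)

theorem mem_Icc_of_tendsto (hθ : θ ∈ G.Θ) {c : ℝ × ℝ} (hc : G.IsCell θ c)
    (hx : Tendsto (G.xIter A θ c) atTop (𝓝 x)) : x ∈ Icc c.1 c.2 :=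
  isClosed_Icc.mem_of_tendsto hx (Eventually.of_forall (H.xIter_mem hθ hc))

theorem isSDSE_of_isOutput (h_tol : G.ToleranceAssumption A)
    (h_single : G.SingletonAssumption A) {u : ℝ} (hout : G.IsOutput A .optimistic u x θ) :
    ∃ y z, G.IsSDSE x y z θ ∧ u = G.UX x y z := by
  obtain ⟨hθ, hcand, -⟩ := id hout
  have hle := fun x' (hx' : x' ∈ G.Ωx) θ' (hθ' : θ' ∈ G.Θ) =>
    H.best_le_of_isOutput h_tol h_single hout hθ' hx'
  -- it suffices that the output utility is a response value and bounds the others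
  suffices h : x ∈ G.Ωx ∧ IsGreatest (G.responseValues x θ) u by
    obtain ⟨hx, hu⟩ := h
    obtain ⟨y, hy, z, hz, rfl⟩ := id hu.1
    refine ⟨y, z, ⟨hx, hθ, hy, hz, hu, fun x' hx' θ' hθ' => ?_⟩, rfl⟩
    have : G.best x θ = _ := hu.csSup_eq
    rw [this]
    exact hle x' hx' θ' hθ'
  have hzero : ∀ hx : x ∈ G.zeros θ, IsGreatest (G.responseValues x θ) (G.best x θ) := fun hx =>
    (H.isCompact_responseValues_of_zero hθ hx).1.isGreatest_sSup
      (H.isCompact_responseValues_of_zero hθ hx).2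
  rcases hcand with ⟨c, hc, hlim, rfl⟩ | ⟨hz, rfl⟩
  · have hxc := H.mem_Icc_of_tendsto hθ hc hlim
    have hx := hc.Icc_subset hxc
    refine ⟨hx, ?_⟩
    by_cases h0 : G.f₂ x θ = 0
    · refine ⟨?_, fun v hv => ((hzero ⟨hx, h0⟩).2 hv).trans (hle x hx θ hθ)⟩
      rw [H.responseValues_eq_image hθ hx, BRY_eq_Ωy h0]
      exact ⟨_, H.φ₁_mem θ c, rfl⟩
    · rw [H.responseValues_of_ne hθ hc hxc h0]
      exact isGreatest_singleton
  · exact ⟨hz.1, by rw [← H.best_of_zero hθ hz]; exact hzero hz⟩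

/-- Along the interior of an interval the pessimistic utility tends to the utility `UXhat` of the
closed interval, at the endpoints too. -/
theorem tendsto_worst (hθ : θ ∈ G.Θ) {c : ℝ × ℝ} (hc : G.IsCell θ c) (hx : x ∈ Icc c.1 c.2) :
    Tendsto (fun t => G.worst t θ) (𝓝[Ioo c.1 c.2] x) (𝓝 (G.UXhat θ c x)) := by
  have h1 := ((H.continuousOn_UXhat hθ c) x (hc.Icc_subset hx)).tendsto.mono_left
    (nhdsWithin_mono x (Ioo_subset_Icc_self.trans hc.Icc_subset))
  refine h1.congr' ?_
  filter_upwards [self_mem_nhdsWithin] with t ht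
  exact (H.worst_of_ne hθ hc (Ioo_subset_Icc_self ht) (hc.2.2.2.2.2 t ht)).symm

omit H in
theorem _root_.Deception.Game.IsCell.nhdsWithin_Ioo_neBot {c : ℝ × ℝ} (hc : G.IsCell θ c)
    (hx : x ∈ Icc c.1 c.2) : (𝓝[Ioo c.1 c.2] x).NeBot := by
  rw [← mem_closure_iff_nhdsWithin_neBot, closure_Ioo hc.1.ne]
  exact hx

theorem isLUB_of_isOutput (h_tol : G.ToleranceAssumption A)
    (h_single : G.SingletonAssumption A) {u : ℝ} (hout : G.IsOutput A .pessimistic u x θ) :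
    IsLUB {v | ∃ x' ∈ G.Ωx, ∃ θ' ∈ G.Θ, v = G.worst x' θ'} u := by
  refine ⟨?_, fun b hb => ?_⟩
  · rintro _ ⟨x', hx', θ', hθ', rfl⟩
    exact H.worst_le_of_isOutput h_tol h_single hout hθ' hx'
  · obtain ⟨hθ, ⟨c, hc, hlim, rfl⟩ | ⟨hz, rfl⟩, -⟩ := hout
    · have hxc := H.mem_Icc_of_tendsto hθ hc hlim
      have := hc.nhdsWithin_Ioo_neBot hxc
      refine le_of_tendsto (H.tendsto_worst hθ hc hxc) ?_
      filter_upwards [self_mem_nhdsWithin] with t ht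
      exact hb ⟨t, hc.Icc_subset (Ioo_subset_Icc_self ht), θ, hθ, rfl⟩
    · rw [← H.worst_of_zero hθ hz]
      exact hb ⟨x, hz.1, θ, hθ, rfl⟩

theorem isWDSE_of_isOutput (h_tol : G.ToleranceAssumption A)
    (h_single : G.SingletonAssumption A) {u : ℝ} (hout : G.IsOutput A .pessimistic u x θ)
    (h : G.f₂ x θ ≠ 0 ∨ UpperSemicontinuousWithinAt (fun t => G.worst t θ) G.Ωx x) :
    ∃ y z, G.IsWDSE x y z θ ∧ u = G.UX x y z := by
  obtain ⟨hθ, hcand, -⟩ := id hout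
  have hle := fun x' (hx' : x' ∈ G.Ωx) θ' (hθ' : θ' ∈ G.Θ) =>
    H.worst_le_of_isOutput h_tol h_single hout hθ' hx'
  suffices h : x ∈ G.Ωx ∧ IsLeast (G.responseValues x θ) u by
    obtain ⟨hx, hu⟩ := h
    obtain ⟨y, hy, z, hz, rfl⟩ := id hu.1
    refine ⟨y, z, ⟨hx, hθ, hy, hz, hu, fun x' hx' θ' hθ' => ?_⟩, rfl⟩
    have : G.worst x θ = _ := hu.csInf_eq
    rw [this]
    exact hle x' hx' θ' hθ'
  have hzero : ∀ hx : x ∈ G.zeros θ, IsLeast (G.responseValues x θ) (G.worst x θ) := fun hx =>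
    (H.isCompact_responseValues_of_zero hθ hx).1.isLeast_sInf
      (H.isCompact_responseValues_of_zero hθ hx).2
  rcases hcand with ⟨c, hc, hlim, rfl⟩ | ⟨hz, rfl⟩
  · have hxc := H.mem_Icc_of_tendsto hθ hc hlim
    have hx := hc.Icc_subset hxc
    refine ⟨hx, ?_⟩
    by_cases h0 : G.f₂ x θ = 0
    · have husc := h.resolve_left (not_not.2 h0)
      -- semicontinuity bounds the limit along the interval by the value at its endpoint
      have hge : G.UXhat θ c x ≤ G.worst x θ := by
        by_contra! hlt
        obtain ⟨b, hb1, hb2⟩ := exists_between hlt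
        have := hc.nhdsWithin_Ioo_neBot hxc
        have h1 : ∀ᶠ t in 𝓝[Ioo c.1 c.2] x, G.worst t θ < b :=
          (husc b hb1).filter_mono
            (nhdsWithin_mono x (Ioo_subset_Icc_self.trans hc.Icc_subset))
        have h2 := le_of_tendsto (H.tendsto_worst hθ hc hxc) (h1.mono fun t ht => ht.le)
        linarith
      rw [le_antisymm hge (hle x hx θ hθ)]
      exact hzero ⟨hx, h0⟩
    · rw [H.responseValues_of_ne hθ hc hxc h0]
      exact isLeast_singleton
  · exact ⟨hz.1, by rw [← H.worst_of_zero hθ hz]; exact hzero hz⟩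

end Hypotheses

theorem IsWDSE.upperSemicontinuousWithinAt {x y : ℝ} {z : E N} {θ : E m}
    (h : G.IsWDSE x y z θ) : UpperSemicontinuousWithinAt (fun t => G.worst t θ) G.Ωx x := by
  intro b hb
  filter_upwards [self_mem_nhdsWithin] with t ht
  exact (h.2.2.2.2.2 t ht θ h.2.1).trans_lt hb

end Game

end Deception

theorem mainTheorem2 {N m : ℕ} (G : Deception.Game N m) (A : Deception.AlgInput N m) (μ κ : ℝ)
    (h_nondeg : G.Nondegenerate)
    (h_util : G.UtilityAssumption)
    (h_mono : G.MonotoneAssumption μ κ)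
    (h_reg : G.RegularityAssumption)
    (h_conc : G.ConcavityAssumption)
    (h_input : G.AdmissibleInput A μ κ)
    (h_tol : G.ToleranceAssumption A)
    (h_single : G.SingletonAssumption A) :
    -- on each interval the inner loops terminate and the iterates converge
    (∀ θ ∈ G.Θ, ∀ c, G.IsCell θ c →
      (∀ k, G.InnerLoopTerminates A θ (G.xIter A θ c k) (G.φ₁ θ c) (G.iter A θ c k).2.1 (A.σ k)) ∧
      ∃ x ∈ Set.Icc c.1 c.2,
        Filter.Tendsto (G.xIter A θ c) Filter.atTop (nhds x)) ∧
    -- the algorithm has an output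
    (∀ att : Deception.Attitude, ∃ u x θ, G.IsOutput A att u x θ) ∧
    -- every optimistic output is an SDSE strategy
    (∀ u x θ, G.IsOutput A .optimistic u x θ →
      ∃ y z, G.IsSDSE x y z θ ∧ u = G.UX x y z) ∧
    -- every pessimistic output has the optimal pessimistic utility, and it is a WDSE strategy
    -- exactly if `x` is no zero of `f₂(·, θ)` or the pessimistic utility is u.s.c. at `x`
    (∀ u x θ, G.IsOutput A .pessimistic u x θ →
      IsLUB {v | ∃ x' ∈ G.Ωx, ∃ θ' ∈ G.Θ, v = G.worst x' θ'} u ∧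
      ((∃ y z, G.IsWDSE x y z θ ∧ u = G.UX x y z) ↔
        (G.f₂ x θ ≠ 0 ∨ UpperSemicontinuousWithinAt (fun t => G.worst t θ) G.Ωx x))) := by
  have H : G.Hypotheses A μ κ := ⟨h_nondeg, h_util, h_mono, h_reg, h_conc, h_input⟩
  refine ⟨fun θ hθ c hc => ⟨fun k => ?_, ?_⟩, H.exists_isOutput h_tol h_single,
    fun u x θ hout => H.isSDSE_of_isOutput h_tol h_single hout,
    fun u x θ hout => ⟨H.isLUB_of_isOutput h_tol h_single hout, ?_,
      H.isWDSE_of_isOutput h_tol h_single hout⟩⟩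
  · exact H.innerLoopTerminates hθ (hc.Icc_subset (H.xIter_mem hθ hc k)) (H.φ₁_mem θ c)
      (H.zIter_mem hθ hc k) (h_input.sigma_pos k)
  · obtain ⟨l, hl, hlim, -⟩ := H.xIter_tendsto h_tol h_single hθ hc
    exact ⟨l, hl, hlim⟩
  · rintro ⟨y, z, hW, -⟩
    exact .inr hW.upperSemicontinuousWithinAt
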